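/- Let $\mathbb{N}=\{1,2,3,\dots\}$ and $\mathbb{N}_0=\{0,1,2,\dots\}$. For $\mathbf{d},m,n\in\mathbb{N}$, $s\in\mathbb{N}_0$ and $\theta\in\mathbb{R}^{\mathbf d}$ with $\mathbf d\ge s+mn+m$ let $A^{\theta,s}_{m,n}\colon\mathbb{R}^n\to\mathbb{R}^m$ be the affine function whose $i$-th component is $x\mapsto \bigl[\sum_{j=1}^n\theta_{s+(i-1)n+j}\,x_j\bigr]+\theta_{s+mn+i}$. For $u<v$, $\mathbf{L}\in\mathbb{N}$, $\mathbf{l}=(\mathbf{l}_0,\dots,\mathbf{l}_{\mathbf L})\in\mathbb{N}^{\mathbf L+1}$ and $\theta\in\mathbb{R}^{\mathbf d}$ with $\mathbf d\ge\sum_{i=1}^{\mathbf L}\mathbf{l}_i(\mathbf{l}_{i-1}+1)$ let the clipped ReLU network $\mathscr{N}^{\theta,\mathbf l}_{u,v}\colon\mathbb{R}^{\mathbf l_0}\to\mathbb{R}^{\mathbf l_{\mathbf L}}$ be $$\mathscr{N}^{\theta,\mathbf l}_{u,v}=\mathfrak{C}_{u,v}\circ A^{\theta,s_{\mathbf L}}_{\mathbf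 l_{\mathbf L},\mathbf l_{\mathbf L-1}}\circ\mathfrak{R}\circ A^{\theta,s_{\mathbf L-1}}_{\mathbf l_{\mathbf L-1},\mathbf l_{\mathbf L-2}}\circ\cdots\circ\mathfrak{R}\circ A^{\theta,s_1}_{\mathbf l_1,\mathbf l_0},\qquad s_k=\sum_{i=1}^{k-1}\mathbf l_i(\mathbf l_{i-1}+1),$$ where $\mathfrak{R}$ applies $x\mapsto\max\{x,0\}$ and $\mathfrak{C}_{u,v}$ applies $x\mapsto\max\{\min\{x,v\},u\}$ to each component (for $\mathbf L=1$ it is $\mathfrak{C}_{u,v}\circ A^{\theta,0}_{\mathbf l_1,\mathbf l_0}$). Let $\|\cdot\|_\infty$ denote the maximum norm; in particular $\|\mathbf l\|_\infty=\max\{\mathbf l_0,\dots,\mathbf l_{\mathbf L}\}$. **Proposition.** Let $d,\mathbf d,\mathbf L,M,K,N\in\mathbb{N}$, $p\in(0,\infty)$, $a,u\in\mathbb{R}$, $b\in(a,\infty)$, $v\in(u,\infty)$, $c\in[\max\{1,|a|,|b|\},\infty)$, $\beta\in[c,\infty)$, $\mathbf l=(\mathbf l_0,\dots,\mathbf l_{\mathbf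 L})\in\mathbb{N}^{\mathbf L+1}$, $\mathfrak{N}\subseteq\{0,1,\dots,N\}$ satisfy $0\in\mathfrak N$, $\mathbf l_0=d$, $\mathbf l_{\mathbf L}=1$ and $\mathbf d\ge\sum_{i=1}^{\mathbf L}\mathbf l_i(\mathbf l_{i-1}+1)$. Let $(\Omega,\mathcal F,\mathbb P)$ be a probability space, let $(X_j,Y_j)\colon\Omega\to[a,b]^d\times[u,v]$, $j\in\{1,\dots,M\}$, be i.i.d. random variables, let $\mathcal E\colon[a,b]^d\to[u,v]$ be measurable and such that $\mathbb P$-a.s. $\mathcal E(X_1)=\mathbb E[Y_1\mid X_1]$. Let $\Theta_{k,n}\colon\Omega\to\mathbb{R}^{\mathbf d}$, $k,n\in\mathbb{N}_0$, and $\mathbf k\colon\Omega\to(\mathbb{N}_0)^2$ be random variables such that $\Theta_{k,0}$, $k\in\{1,\dots,K\}$, are i.i.d. and $\Theta_{1,0}$ is continuously uniformly distributed on $[-c,c]^{\mathbf d}$. Let $\mathcal R\colon\mathbb{R}^{\mathbf d}\times\Omega\to[0,\infty)$ be given by $$\mathcal R(\theta,\omega)=\frac1M\sum_{j=1}^M\bigl|\mathscr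 N^{\theta,\mathbf l}_{u,v}(X_j(\omega))-Y_j(\omega)\bigr|^2,$$ and assume for all $\omega\in\Omega$ that $$\mathbf k(\omega)\in\operatorname*{arg\,min}_{(k,n)\in\{1,\dots,K\}\times\mathfrak N,\ \|\Theta_{k,n}(\omega)\|_\infty\le\beta}\mathcal R(\Theta_{k,n}(\omega),\omega).$$ Then (i) the function $\Omega\ni\omega\mapsto\int_{[a,b]^d}\bigl|\mathscr N^{\Theta_{\mathbf k(\omega)}(\omega),\mathbf l}_{u,v}(x)-\mathcal E(x)\bigr|^2\,\mathbb P_{X_1}(\mathrm dx)\in[0,\infty]$ is measurable, where $\mathbb P_{X_1}$ is the law of $X_1$, and (ii) it holds that $$\begin{aligned}&\left(\mathbb E\!\left[\left(\int_{[a,b]^d}\bigl|\mathscr N^{\Theta_{\mathbf k},\mathbf l}_{u,v}(x)-\mathcal E(x)\bigr|^2\,\mathbb P_{X_1}(\mathrm dx)\right)^{p}\right]\right)^{1/p}\\&\le\inf_{\theta\in[-c,c]^{\mathbf d}}\ \sup_{x\in[a,b]^d}\bigl|\mathscr N^{\theta,\mathbf l}_{u,v}(x)-\mathcal E(x)\bigr|^2+\frac{4(v-u)\,\mathbf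 L\,(\|\mathbf l\|_\infty+1)^{\mathbf L}\,c^{\mathbf L+1}\max\{p,1\}}{K^{[\mathbf L^{-1}(\|\mathbf l\|_\infty+1)^{-2}]}}\\&\quad+\frac{10\,(\max\{v-u,1\})^2\,\mathbf L\,(\|\mathbf l\|_\infty+1)^{3/2}\max\{p,\ln(4M\beta c)\}}{\sqrt M}.\end{aligned}$$ -/

import Mathlib

open MeasureTheory ProbabilityTheory
open scoped ENNReal

namespace ClippedDNN

/-- The `i`-th entry (counted from `0`) of a parameter vector; the value `0` beyond the length of
the vector is never used when the vector is long enough for the network under consideration. -/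
noncomputable def entry {D : ℕ} (θ : Fin D → ℝ) (i : ℕ) : ℝ :=
  if h : i < D then θ ⟨i, h⟩ else 0

/-- The affine function `ℝⁿ → ℝᵐ` whose `m × n` matrix (row by row) and then whose offset vector
are stored in `θ` in consecutive positions, starting after the first `s` entries. -/
noncomputable def affine {D : ℕ} (θ : Fin D → ℝ) (s m n : ℕ) (x : Fin n → ℝ) : Fin m → ℝ :=
  fun i => (∑ j : Fin n, entry θ (s + (i : ℕ) * n + (j : ℕ)) * x j) +
    entry θ (s + m * n + (i : ℕ))

/-- `numParams l k = ∑_{i=1}^{k} l_i (l_{i-1} + 1)`, the number of real parameters of the first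
`k` layers of a network with layer dimensions `l 0, l 1, l 2, …`. -/
def numParams (l : ℕ → ℕ) (k : ℕ) : ℕ :=
  ∑ i ∈ Finset.range k, l (i + 1) * (l i + 1)

/-- The fully connected feedforward network with layer dimensions `l 0, …, l k` and activation
functions `act 1, …, act k`:
`act k ∘ A_k ∘ act (k-1) ∘ A_{k-1} ∘ ⋯ ∘ act 1 ∘ A_1`, where `A_i : ℝ^(l (i-1)) → ℝ^(l i)` is
affine and its parameters are read from `θ` after the first `numParams l (i-1)` entries. -/
noncomputable def network {D : ℕ} (θ : Fin D → ℝ) (l : ℕ → ℕ)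
    (act : (i : ℕ) → (Fin (l i) → ℝ) → (Fin (l i) → ℝ)) :
    (k : ℕ) → (Fin (l 0) → ℝ) → (Fin (l k) → ℝ)
  | 0, x => x
  | k + 1, x =>
      act (k + 1) (affine θ (numParams l k) (l (k + 1)) (l k) (network θ l act k x))

/-- The rectifier function. -/
noncomputable def relu (x : ℝ) : ℝ := max x 0

/-- The clipping function. -/
noncomputable def clip (u v x : ℝ) : ℝ := max (min x v) u

/-- The rectified clipped network with `L` layers of dimensions `l 0, …, l L`: the activation
function is the componentwise rectifier in the layers `1, …, L - 1` and the componentwise clipping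
function in the last layer `L`. -/
noncomputable def clippedNetwork {D : ℕ} (L : ℕ) (l : ℕ → ℕ) (u v : ℝ) (θ : Fin D → ℝ) :
    (Fin (l 0) → ℝ) → (Fin (l L) → ℝ) :=
  network θ l (fun i y j => if i = L then clip u v (y j) else relu (y j)) L

/-- The rectified clipped network as a function `ℝᵈ → ℝ` if `l 0 = d` and `l L = 1`. -/
noncomputable def realNetwork {D d : ℕ} (L : ℕ) (l : ℕ → ℕ) (h0 : l 0 = d) (hL : l L = 1)
    (u v : ℝ) (θ : Fin D → ℝ) (x : Fin d → ℝ) : ℝ :=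
  clippedNetwork L l u v θ (fun i => x (Fin.cast h0 i)) (Fin.cast hL.symm 0)

/-- The maximum norm of the vector `(l 0, l 1, …, l L)` of layer dimensions. -/
def width (L : ℕ) (l : ℕ → ℕ) : ℕ := (Finset.range (L + 1)).sup l

/-- The hypercube `[a,b]ⁿ`. -/
def cube (n : ℕ) (a b : ℝ) : Set (Fin n → ℝ) := Set.Icc (fun _ => a) (fun _ => b)

/-- The set of minimizers of `f` over `s`. -/
def argminOn {α : Type*} (f : α → ℝ) (s : Set α) : Set α := {q | q ∈ s ∧ IsMinOn f s q}

end ClippedDNN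

/-! Since `E` is the regression function, the squared L²-distance err(θ) of the network f_θ to `E`
equals risk(f_θ) − risk(E) (`integral_sq_sub_regression`). Fix ϑ in [-c,c]^D and let Θ_{k,0} be the
starting vector nearest to ϑ. The selected vector has empirical risk at most that of Θ_{k,0}, which
exceeds that of ϑ by at most a Lipschitz constant times the distance, because networks are Lipschitz
in their parameters (`abs_realNetwork_sub_le`). Passing between empirical risk and risk, at the
selected vector and at ϑ, costs twice the uniform deviation over the ball of radius β. Hence almost
surely err(selected) ≤ err(ϑ) + B · (normalized minimal distance) + 2 · (uniform deviation). The
bound is pathwise, so parameters and data need not be independent. Minkowski's inequality in L^q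
with q = max p 1, err(ϑ) ≤ sup |f_ϑ − E|², and the infimum over ϑ finish the proof.

Both random terms have Weibull type tails, which `eLpNorm_le_of_tail` turns into moments. Random
search: a uniform vector is within 2ct of ϑ in its first n coordinates with probability at least
t^n, so the minimum over K independent vectors has tail exp(-K t^n) and norm of order K^(-1/n). Here
n ≤ L W² counts the network parameters and W is the width plus one. Generalization: Hoeffding's
inequality at one parameter and a union bound over a grid (`eLpNorm_sup'_le`). The grid is so fine
that discretization costs only O(1/√M), while the logarithm of its cardinality stays of order L² W³
Λ² with Λ = max p (ln(4Mβc)). -/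

namespace ClippedDNN

/-! ### Size and Lipschitz bounds for general networks -/

section Network

variable {D : ℕ}

lemma abs_entry_le (θ : Fin D → ℝ) (i : ℕ) : |entry θ i| ≤ ‖θ‖ := by
  unfold entry
  split_ifs with h
  · exact norm_le_pi_norm θ ⟨i, h⟩
  · simp

lemma continuous_entry (i : ℕ) : Continuous fun θ : Fin D → ℝ => entry θ i := by
  unfold entry
  split_ifs with h
  · exact continuous_apply _
  · exact continuous_const

lemma numParams_succ (l : ℕ → ℕ) (k : ℕ) :
    numParams l (k + 1) = numParams l k + l (k + 1) * (l k + 1) := by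
  simp [numParams, Finset.sum_range_succ]

lemma numParams_mono (l : ℕ → ℕ) : Monotone (numParams l) :=
  monotone_nat_of_le_succ fun k => by rw [numParams_succ]; exact Nat.le_add_right _ _

lemma weight_index_lt {s m n i j : ℕ} (hi : i < m) (hj : j < n) :
    s + i * n + j < s + m * (n + 1) := by
  have : (i + 1) * n ≤ m * n := Nat.mul_le_mul_right n hi
  nlinarith

lemma offset_index_lt {s m n i : ℕ} (hi : i < m) : s + m * n + i < s + m * (n + 1) := by
  nlinarith

lemma abs_affine_le {θ : Fin D → ℝ} {s m n : ℕ} {B H : ℝ} (hH : 1 ≤ H)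
    (hθ : ∀ i < s + m * (n + 1), |entry θ i| ≤ B) {x : Fin n → ℝ} (hx : ∀ j, |x j| ≤ H)
    (i : Fin m) : |affine θ s m n x i| ≤ (n + 1) * B * H := by
  have hB : 0 ≤ B := (abs_nonneg _).trans (hθ _ (offset_index_lt i.2))
  have h1 : |∑ j : Fin n, entry θ (s + (i : ℕ) * n + (j : ℕ)) * x j| ≤ ∑ _j : Fin n, B * H := by
    refine (Finset.abs_sum_le_sum_abs _ _).trans (Finset.sum_le_sum fun j _ => ?_)
    rw [abs_mul]
    exact mul_le_mul (hθ _ (weight_index_lt i.2 j.2)) (hx j) (abs_nonneg _) hB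
  have h2 := hθ _ (offset_index_lt (s := s) (n := n) i.2)
  have h3 : B ≤ B * H := le_mul_of_one_le_right hB hH
  simp only [Finset.sum_const, Finset.card_univ, Fintype.card_fin, nsmul_eq_mul] at h1
  unfold affine
  refine (abs_add_le _ _).trans ?_
  nlinarith

lemma abs_affine_sub_le {θ ϑ : Fin D → ℝ} {s m n : ℕ} {B H δ e : ℝ} (hH : 1 ≤ H)
    (hθ : ∀ i < s + m * (n + 1), |entry θ i| ≤ B)
    (hδ : ∀ i < s + m * (n + 1), |entry θ i - entry ϑ i| ≤ δ)
    {x y : Fin n → ℝ} (hy : ∀ j, |y j| ≤ H) (hxy : ∀ j, |x j - y j| ≤ e) (i : Fin m) :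
    |affine θ s m n x i - affine ϑ s m n y i| ≤ n * B * e + (n + 1) * δ * H := by
  have hB : 0 ≤ B := (abs_nonneg _).trans (hθ _ (offset_index_lt i.2))
  have hδ0 : 0 ≤ δ := (abs_nonneg _).trans (hδ _ (offset_index_lt i.2))
  have h1 : |∑ j : Fin n, (entry θ (s + (i : ℕ) * n + (j : ℕ)) * x j
      - entry ϑ (s + (i : ℕ) * n + (j : ℕ)) * y j)| ≤ ∑ _j : Fin n, (B * e + δ * H) := by
    refine (Finset.abs_sum_le_sum_abs _ _).trans (Finset.sum_le_sum fun j _ => ?_)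
    -- With this splitting only `θ` and `y` need a priori bounds.
    have : entry θ (s + (i : ℕ) * n + (j : ℕ)) * x j - entry ϑ (s + (i : ℕ) * n + (j : ℕ)) * y j
        = entry θ (s + (i : ℕ) * n + (j : ℕ)) * (x j - y j)
          + (entry θ (s + (i : ℕ) * n + (j : ℕ)) - entry ϑ (s + (i : ℕ) * n + (j : ℕ))) * y j := by
      ring
    rw [this]
    refine (abs_add_le _ _).trans ?_
    rw [abs_mul, abs_mul]
    exact add_le_add
      (mul_le_mul (hθ _ (weight_index_lt i.2 j.2)) (hxy j) (abs_nonneg _) hB)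
      (mul_le_mul (hδ _ (weight_index_lt i.2 j.2)) (hy j) (abs_nonneg _) hδ0)
  have h2 := hδ _ (offset_index_lt (s := s) (n := n) i.2)
  have h3 : δ ≤ δ * H := le_mul_of_one_le_right hδ0 hH
  simp only [Finset.sum_const, Finset.card_univ, Fintype.card_fin, nsmul_eq_mul,
    Finset.sum_sub_distrib] at h1
  unfold affine
  rw [add_sub_add_comm]
  refine (abs_add_le _ _).trans ?_
  nlinarith

lemma continuous_affine {Z : Type*} [TopologicalSpace Z] {f : Z → Fin D → ℝ} (hf : Continuous f)
    {s m n : ℕ} {g : Z → Fin n → ℝ} (hg : Continuous g) :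
    Continuous fun z => affine (f z) s m n (g z) := by
  unfold affine
  refine continuous_pi fun i => Continuous.add (continuous_finsetSum _ fun j _ => ?_) ?_
  · exact ((continuous_entry _).comp hf).mul ((continuous_apply j).comp hg)
  · exact (continuous_entry _).comp hf

variable {l : ℕ → ℕ} {act : (i : ℕ) → (Fin (l i) → ℝ) → (Fin (l i) → ℝ)}

/-- Each hidden layer multiplies the size by at most `W * B`; `1 ≤ H` lets the offset be absorbed.
The last layer is left out because clipping may increase absolute values. -/
lemma abs_network_le {θ : Fin D → ℝ} {L : ℕ} {B H W : ℝ} (hB : 1 ≤ B) (hH : 1 ≤ H)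
    (hW : ∀ i ≤ L, (l i : ℝ) + 1 ≤ W) (hact : ∀ i < L, ∀ y j, |act i y j| ≤ |y j|)
    (hθ : ∀ i < numParams l L, |entry θ i| ≤ B) {x : Fin (l 0) → ℝ} (hx : ∀ j, |x j| ≤ H) :
    ∀ k < L, ∀ j, |network θ l act k x j| ≤ H * W ^ k * B ^ k := by
  have hW1 : 1 ≤ W := le_trans (by simp) (hW 0 (Nat.zero_le _))
  intro k
  induction k with
  | zero => intro _ j; simpa [network] using hx j
  | succ k ih =>
    intro hk j
    refine (hact _ hk _ _).trans ?_
    have h1 : 1 ≤ H * W ^ k * B ^ k :=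
      one_le_mul_of_one_le_of_one_le
        (one_le_mul_of_one_le_of_one_le hH (one_le_pow₀ hW1)) (one_le_pow₀ hB)
    refine (abs_affine_le h1 (fun i hi => hθ i ?_) (ih (by omega)) j).trans ?_
    · rw [← numParams_succ] at hi
      exact hi.trans_le (numParams_mono l hk.le)
    · calc ((l k : ℝ) + 1) * B * (H * W ^ k * B ^ k) ≤ W * B * (H * W ^ k * B ^ k) := by
            gcongr
            exact hW k (by omega)
        _ = H * W ^ (k + 1) * B ^ (k + 1) := by ring

/-- A layer enlarges the inherited error by at most `W * B` and adds a fresh error `W * δ` times the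
size bound. All contributions end up of the same order, hence the factor `k`. The last layer is
included since clipping is still nonexpansive. -/
lemma abs_network_sub_le {θ ϑ : Fin D → ℝ} {L : ℕ} {B H W δ : ℝ} (hB : 1 ≤ B) (hH : 1 ≤ H)
    (hδ0 : 0 ≤ δ) (hW : ∀ i ≤ L, (l i : ℝ) + 1 ≤ W)
    (hact : ∀ i < L, ∀ y j, |act i y j| ≤ |y j|)
    (hlip : ∀ i y y' j, |act i y j - act i y' j| ≤ |y j - y' j|)
    (hθ : ∀ i < numParams l L, |entry θ i| ≤ B) (hϑ : ∀ i < numParams l L, |entry ϑ i| ≤ B)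
    (hδ : ∀ i < numParams l L, |entry θ i - entry ϑ i| ≤ δ)
    {x : Fin (l 0) → ℝ} (hx : ∀ j, |x j| ≤ H) :
    ∀ k ≤ L, ∀ j, |network θ l act k x j - network ϑ l act k x j|
      ≤ k * δ * H * W ^ k * B ^ (k - 1) := by
  have hW1 : 1 ≤ W := le_trans (by simp) (hW 0 (Nat.zero_le _))
  intro k
  induction k with
  | zero => intro _ j; simp [network]
  | succ k ih =>
    intro hk j
    refine (hlip _ _ _ _).trans ?_
    have h1 : 1 ≤ H * W ^ k * B ^ k :=
      one_le_mul_of_one_le_of_one_le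
        (one_le_mul_of_one_le_of_one_le hH (one_le_pow₀ hW1)) (one_le_pow₀ hB)
    have hlt : ∀ i < numParams l k + l (k + 1) * (l k + 1), i < numParams l L := fun i hi => by
      rw [← numParams_succ] at hi
      exact hi.trans_le (numParams_mono l hk)
    refine (abs_affine_sub_le h1 (fun i hi => hθ i (hlt i hi)) (fun i hi => hδ i (hlt i hi))
      (abs_network_le hB hH hW hact hϑ hx k hk) (ih (by omega)) j).trans ?_
    have hlk := hW k (by omega)
    -- The exponent `k - 1` is truncated; for `k = 0` both sides vanish through the factor `k`.
    have hpow : B * (k * δ * H * W ^ k * B ^ (k - 1)) = k * δ * H * W ^ k * B ^ k := by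
      rcases k with _ | k
      · simp
      · simp only [Nat.add_sub_cancel]; ring
    calc (l k : ℝ) * B * (k * δ * H * W ^ k * B ^ (k - 1))
          + ((l k : ℝ) + 1) * δ * (H * W ^ k * B ^ k)
        = (l k : ℝ) * (k * δ * H * W ^ k * B ^ k)
          + ((l k : ℝ) + 1) * δ * (H * W ^ k * B ^ k) := by rw [mul_assoc, hpow]
      _ ≤ W * (k * δ * H * W ^ k * B ^ k) + W * δ * (H * W ^ k * B ^ k) := by
        gcongr
        linarith
      _ = ((k + 1 : ℕ) : ℝ) * δ * H * W ^ (k + 1) * B ^ (k + 1 - 1) := by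
        simp only [Nat.add_sub_cancel]; push_cast; ring

lemma continuous_network (hact : ∀ i, Continuous (act i)) (k : ℕ) :
    Continuous fun z : (Fin D → ℝ) × (Fin (l 0) → ℝ) => network z.1 l act k z.2 := by
  induction k with
  | zero => exact continuous_snd
  | succ k ih => exact (hact _).comp (continuous_affine continuous_fst ih)

lemma clip_mem_Icc {u v : ℝ} (huv : u ≤ v) (x : ℝ) : clip u v x ∈ Set.Icc u v :=
  ⟨le_max_right _ _, max_le (min_le_right _ _) huv⟩

lemma abs_clip_sub_clip_le (u v x y : ℝ) : |clip u v x - clip u v y| ≤ |x - y| := by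
  refine (abs_max_sub_max_le_abs _ _ _).trans ((abs_min_sub_min_le_max _ _ _ _).trans ?_)
  simp

lemma abs_relu_sub_relu_le (x y : ℝ) : |relu x - relu y| ≤ |x - y| :=
  abs_max_sub_max_le_abs _ _ _

lemma abs_relu_le (x : ℝ) : |relu x| ≤ |x| := by
  simpa [relu] using abs_relu_sub_relu_le x 0

end Network

/-! ### The clipped ReLU network and its number of parameters -/

section RealNetwork

variable {D d L : ℕ} {l : ℕ → ℕ} {h0 : l 0 = d} {hL : l L = 1} {u v : ℝ}

lemma le_width (l : ℕ → ℕ) {L i : ℕ} (hi : i ≤ L) : l i ≤ width L l :=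
  Finset.le_sup (f := l) (Finset.mem_range.2 (Nat.lt_succ_of_le hi))

lemma realNetwork_mem_Icc (hLpos : 0 < L) (huv : u ≤ v) (θ : Fin D → ℝ) (x : Fin d → ℝ) :
    realNetwork L l h0 hL u v θ x ∈ Set.Icc u v := by
  obtain ⟨k, rfl⟩ := Nat.exists_eq_succ_of_ne_zero hLpos.ne'
  simp only [realNetwork, clippedNetwork, network, if_true]
  exact clip_mem_Icc huv _

lemma abs_realNetwork_sub_le {θ ϑ : Fin D → ℝ} {B H δ : ℝ} (hB : 1 ≤ B) (hH : 1 ≤ H)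
    (hδ0 : 0 ≤ δ) (hθ : ∀ i < numParams l L, |entry θ i| ≤ B)
    (hϑ : ∀ i < numParams l L, |entry ϑ i| ≤ B)
    (hδ : ∀ i < numParams l L, |entry θ i - entry ϑ i| ≤ δ)
    {x : Fin d → ℝ} (hx : ∀ j, |x j| ≤ H) :
    |realNetwork L l h0 hL u v θ x - realNetwork L l h0 hL u v ϑ x|
      ≤ L * δ * H * ((width L l : ℝ) + 1) ^ L * B ^ (L - 1) := by
  refine abs_network_sub_le hB hH hδ0 (fun i hi => ?_) (fun i hi y j => ?_) (fun i y y' j => ?_)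
    hθ hϑ hδ (fun j => hx _) L le_rfl _
  · have := le_width l hi
    exact_mod_cast Nat.add_le_add_right this 1
  · simpa [hi.ne] using abs_relu_le _
  · split_ifs
    · exact abs_clip_sub_clip_le _ _ _ _
    · exact abs_relu_sub_relu_le _ _

lemma continuous_realNetwork :
    Continuous fun z : (Fin D → ℝ) × (Fin d → ℝ) => realNetwork L l h0 hL u v z.1 z.2 := by
  have h := continuous_network (D := D) (l := l)
    (act := fun i y j => if i = L then clip u v (y j) else relu (y j)) (fun i => ?_) L
  · have h2 : Continuous fun z : (Fin D → ℝ) × (Fin d → ℝ) =>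
        (z.1, fun i : Fin (l 0) => z.2 (Fin.cast h0 i)) := by fun_prop
    exact (continuous_apply _).comp (h.comp h2)
  · refine continuous_pi fun j => ?_
    split_ifs
    · exact ((continuous_apply j).min continuous_const).max continuous_const
    · exact (continuous_apply j).max continuous_const

/-- Used twice: it keeps the moment order `⌈q / n⌉` at most `q`, and it absorbs `log 2 + 1` in the
count of grid points. -/
lemma two_le_numParams (hLpos : 0 < L) (hl : ∀ i ≤ L, 0 < l i) : 2 ≤ numParams l L := by
  have h1 : numParams l 1 ≤ numParams l L := numParams_mono l hLpos
  have h2 : numParams l 1 = l 1 * (l 0 + 1) := by simp [numParams]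
  have := hl 0 (Nat.zero_le _)
  have := hl 1 hLpos
  nlinarith

lemma numParams_le (L : ℕ) (l : ℕ → ℕ) : numParams l L ≤ L * (width L l + 1) ^ 2 := by
  have : ∀ i ∈ Finset.range L, l (i + 1) * (l i + 1) ≤ (width L l + 1) ^ 2 := fun i hi => by
    rw [Finset.mem_range] at hi
    rw [sq]
    exact Nat.mul_le_mul ((le_width l hi).trans (Nat.le_succ _))
      (Nat.add_le_add_right (le_width l hi.le) 1)
  simpa [numParams] using Finset.sum_le_sum this

end RealNetwork

/-- A random variable with Weibull type tails has the corresponding moments. -/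
lemma eLpNorm_le_of_tail {Ω : Type*} [MeasurableSpace Ω] {P : Measure Ω} {Z : Ω → ℝ}
    (hZ : Measurable Z) (hZ0 : ∀ ω, 0 ≤ Z ω) {e m : ℕ} (he : 0 < e) (hm : 0 < m) {C κ : ℝ}
    (hC : 0 ≤ C) (hκ : 0 < κ)
    (htail : ∀ t, 0 ≤ t → P {ω | t < Z ω} ≤ ENNReal.ofReal (C * Real.exp (-κ * t ^ e))) :
    eLpNorm Z (ENNReal.ofReal (e * m)) P
      ≤ ENNReal.ofReal (C ^ (1 / ((e : ℝ) * m)) * (m / κ) ^ (1 / (e : ℝ))) := by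
  have he' : (0 : ℝ) < e := by exact_mod_cast he
  have hm' : (0 : ℝ) < m := by exact_mod_cast hm
  have hem : (0 : ℝ) < e * m := by positivity
  have hem1 : (1 : ℝ) ≤ e * m := by
    have : 1 ≤ e * m := Nat.mul_pos he hm
    exact_mod_cast this
  have hint : ∫ t in Set.Ioi (0 : ℝ), t ^ ((e : ℝ) * m - 1) * Real.exp (-κ * t ^ (e : ℝ))
      = κ ^ (-(m : ℝ)) * (1 / e) * Real.Gamma m := by
    rw [integral_rpow_mul_exp_neg_mul_rpow he' (by linarith) hκ]
    have : ((e : ℝ) * m - 1 + 1) / e = m := by field_simp; ring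
    rw [neg_div, this]
  have hmom : ∫⁻ ω, ENNReal.ofReal (Z ω ^ ((e : ℝ) * m)) ∂P
      ≤ ENNReal.ofReal (C * (m / κ) ^ (m : ℝ)) := by
    -- Layer cake formula; inserting the tail bound leaves a Gamma integral.
    rw [lintegral_rpow_eq_lintegral_meas_lt_mul P (ae_of_all _ hZ0) hZ.aemeasurable hem]
    have hpos : 0 < κ ^ (-(m : ℝ)) * (1 / e) * Real.Gamma m := by
      have := Real.Gamma_pos_of_pos hm'
      positivity
    have hI : IntegrableOn (fun t : ℝ => t ^ ((e : ℝ) * m - 1) * Real.exp (-κ * t ^ (e : ℝ)))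
        (Set.Ioi 0) := by
      -- A nonintegrable function has integral `0` by convention, which the positive Gamma value
      -- excludes.
      by_contra h
      have := integral_undef h
      rw [hint] at this
      exact hpos.ne' this
    calc ENNReal.ofReal (e * m) * ∫⁻ t in Set.Ioi (0 : ℝ),
          P {ω | t < Z ω} * ENNReal.ofReal (t ^ ((e : ℝ) * m - 1))
        ≤ ENNReal.ofReal (e * m) * ∫⁻ t in Set.Ioi (0 : ℝ), ENNReal.ofReal
            (C * (t ^ ((e : ℝ) * m - 1) * Real.exp (-κ * t ^ (e : ℝ)))) := by
          gcongr 1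
          refine setLIntegral_mono' measurableSet_Ioi fun t ht => ?_
          have ht0 : (0 : ℝ) ≤ t := le_of_lt ht
          refine (mul_le_mul_left (htail t ht0) _).trans (le_of_eq ?_)
          rw [← ENNReal.ofReal_mul (by positivity), Real.rpow_natCast]
          congr 1; ring
      _ = ENNReal.ofReal (e * m * (C * (κ ^ (-(m : ℝ)) * (1 / e) * Real.Gamma m))) := by
          rw [← ofReal_integral_eq_lintegral_ofReal (hI.const_mul C), integral_const_mul, hint,
            ← ENNReal.ofReal_mul hem.le]
          exact (ae_restrict_iff' measurableSet_Ioi).2 (ae_of_all _ fun t ht => by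
            have : (0 : ℝ) < t := ht
            positivity)
      _ ≤ ENNReal.ofReal (C * (m / κ) ^ (m : ℝ)) := by
          refine ENNReal.ofReal_le_ofReal ?_
          -- An integer order turns m Γ(m) into m! ≤ m^m.
          have h1 : (m : ℝ) * Real.Gamma m ≤ (m : ℝ) ^ (m : ℝ) := by
            rw [← Real.Gamma_add_one hm'.ne', Real.Gamma_nat_eq_factorial, Real.rpow_natCast]
            exact_mod_cast Nat.factorial_le_pow m
          rw [Real.div_rpow hm'.le hκ.le]
          calc (e : ℝ) * m * (C * (κ ^ (-(m : ℝ)) * (1 / e) * Real.Gamma m))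
              = C * ((m * Real.Gamma m) * κ ^ (-(m : ℝ))) := by field_simp
            _ ≤ C * ((m : ℝ) ^ (m : ℝ) * κ ^ (-(m : ℝ))) := by gcongr
            _ = _ := by rw [Real.rpow_neg hκ.le, div_eq_mul_inv]
  rw [eLpNorm_eq_lintegral_rpow_enorm_toReal (ENNReal.ofReal_pos.2 hem).ne' ENNReal.ofReal_ne_top,
    ENNReal.toReal_ofReal hem.le]
  have h2 : ∀ ω, ‖Z ω‖ₑ ^ ((e : ℝ) * m) = ENNReal.ofReal (Z ω ^ ((e : ℝ) * m)) := fun ω => by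
    rw [Real.enorm_eq_ofReal (hZ0 ω), ENNReal.ofReal_rpow_of_nonneg (hZ0 ω) hem.le]
  simp_rw [h2]
  refine (ENNReal.rpow_le_rpow hmom (by positivity)).trans (le_of_eq ?_)
  rw [ENNReal.ofReal_rpow_of_nonneg (by positivity) (by positivity),
    Real.mul_rpow hC (by positivity), ← Real.rpow_mul (by positivity)]
  congr 3
  field_simp

/-! ### Distance of the best of several uniform vectors to a given one -/

section RandomSearch

variable {D : ℕ}

/-- The maximum norm distance of the first `n` entries of two parameter vectors. -/
noncomputable def headDist (n : ℕ) (θ ϑ : Fin D → ℝ) : ℝ :=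
  ‖fun i : Fin n => entry θ i - entry ϑ i‖

lemma headDist_nonneg (n : ℕ) (θ ϑ : Fin D → ℝ) : 0 ≤ headDist n θ ϑ := norm_nonneg _

lemma abs_entry_sub_le_headDist {n : ℕ} (θ ϑ : Fin D → ℝ) {i : ℕ} (hi : i < n) :
    |entry θ i - entry ϑ i| ≤ headDist n θ ϑ :=
  norm_le_pi_norm (fun i : Fin n => entry θ i - entry ϑ i) ⟨i, hi⟩

lemma headDist_le {n : ℕ} {θ ϑ : Fin D → ℝ} {r : ℝ} (hr : 0 ≤ r)
    (h : ∀ i < n, |entry θ i - entry ϑ i| ≤ r) : headDist n θ ϑ ≤ r :=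
  (pi_norm_le_iff_of_nonneg hr).2 fun i => h i i.2

lemma measurable_headDist (n : ℕ) (ϑ : Fin D → ℝ) : Measurable fun θ => headDist n θ ϑ := by
  refine Continuous.measurable (Continuous.norm (continuous_pi fun i => ?_))
  exact (continuous_entry _).sub continuous_const

variable {Ω : Type*}

lemma volume_cube {c : ℝ} (hc : 0 < c) (D : ℕ) :
    volume (cube D (-c) c) = ENNReal.ofReal ((2 * c) ^ D) := by
  rw [cube, Real.volume_Icc_pi]
  simp only [sub_neg_eq_add, Finset.prod_const, Finset.card_univ, Fintype.card_fin]
  rw [← ENNReal.ofReal_pow (by positivity), two_mul]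

/-- The small ball probabilities of the first `n` entries of a uniformly distributed vector. -/
lemma le_measure_headDist_le [MeasurableSpace Ω] {P : Measure Ω} {c : ℝ} (hc : 0 < c) {T : Ω → Fin D → ℝ}
    (hT : pdf.IsUniform T (cube D (-c) c) P volume) {ϑ : Fin D → ℝ} (hϑ : ϑ ∈ cube D (-c) c)
    (n : ℕ) {t : ℝ} (ht0 : 0 ≤ t) (ht1 : t ≤ 1) :
    ENNReal.ofReal (t ^ n) ≤ P {ω | headDist n (T ω) ϑ ≤ 2 * c * t} := by
  have hvol := volume_cube hc D
  have hmeas : MeasurableSet {θ : Fin D → ℝ | headDist n θ ϑ ≤ 2 * c * t} :=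
    measurableSet_le (measurable_headDist n ϑ) measurable_const
  have hpos : 0 < (2 * c) ^ D := by positivity
  have h := hT.measure_preimage (by rw [hvol]; exact (ENNReal.ofReal_pos.2 hpos).ne')
    (by rw [hvol]; exact ENNReal.ofReal_ne_top) hmeas
  rw [show {ω | headDist n (T ω) ϑ ≤ 2 * c * t} = T ⁻¹' {θ | headDist n θ ϑ ≤ 2 * c * t} from rfl,
    h, hvol]
  -- Coordinate `i` of the box below is [-c,c] contracted towards `ϑ i` by the factor `τ i`. It has
  -- length `2 * c * τ i` and stays inside the cube even if `ϑ` is near the boundary.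
  set τ : Fin D → ℝ := fun i => if (i : ℕ) < n then t else 1 with hτ
  have hτ0 : ∀ i, 0 ≤ τ i := fun i => by simp only [hτ]; split_ifs <;> linarith
  have hτ1 : ∀ i, τ i ≤ 1 := fun i => by simp only [hτ]; split_ifs <;> linarith
  have hsub : Set.Icc (fun i => ϑ i - τ i * (ϑ i + c)) (fun i => ϑ i + τ i * (c - ϑ i))
      ⊆ cube D (-c) c ∩ {θ | headDist n θ ϑ ≤ 2 * c * t} := by
    rintro θ ⟨h1, h2⟩
    refine ⟨⟨fun i => ?_, fun i => ?_⟩, headDist_le (by positivity) fun i hi => ?_⟩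
    · have a1 := hϑ.1 i
      have a2 := h1 i
      have a3 := hτ1 i
      dsimp only at a1 a2 ⊢
      nlinarith
    · have a1 := hϑ.2 i
      have a2 := h2 i
      have a3 := hτ1 i
      dsimp only at a1 a2 ⊢
      nlinarith
    · by_cases hiD : i < D
      · have a1 := hϑ.1 ⟨i, hiD⟩
        have a2 := hϑ.2 ⟨i, hiD⟩
        have a3 := h1 ⟨i, hiD⟩
        have a4 := h2 ⟨i, hiD⟩
        have a5 : τ ⟨i, hiD⟩ = t := by simp [hτ, hi]
        dsimp only at a1 a2 a3 a4
        rw [a5] at a3 a4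
        simp only [entry, hiD, dif_pos]
        rw [abs_le]
        constructor <;> nlinarith
      · simp only [entry, hiD, dif_neg, not_false_iff, sub_self, abs_zero]
        positivity
  -- Only `min D n` coordinates are contracted, which suffices because `t ≤ 1`.
  have hprod : t ^ n ≤ ∏ i, τ i := by
    simp only [hτ, Finset.prod_ite, Finset.prod_const, one_pow, mul_one]
    refine pow_le_pow_of_le_one ht0 ht1 ?_
    rw [Fin.card_filter_val_lt]
    exact min_le_right _ _
  rw [ENNReal.le_div_iff_mul_le (Or.inl (ENNReal.ofReal_pos.2 hpos).ne')
    (Or.inl ENNReal.ofReal_ne_top), ← ENNReal.ofReal_mul (by positivity)]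
  refine le_trans ?_ (measure_mono hsub)
  rw [Real.volume_Icc_pi]
  have : ∀ i, ϑ i + τ i * (c - ϑ i) - (ϑ i - τ i * (ϑ i + c)) = τ i * (2 * c) := fun i => by ring
  simp_rw [this]
  rw [← ENNReal.ofReal_prod_of_nonneg fun i _ => mul_nonneg (hτ0 i) (by positivity),
    Finset.prod_mul_distrib, Finset.prod_const, Finset.card_univ, Fintype.card_fin]
  exact ENNReal.ofReal_le_ofReal (by gcongr)

variable {ι : Type*} [Fintype ι] [Nonempty ι]

/-- The normalized minimal distance of the first `n` entries of random vectors to `ϑ`. -/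
noncomputable def minHeadDist (c : ℝ) (n : ℕ) (T : ι → Ω → Fin D → ℝ) (ϑ : Fin D → ℝ) (ω : Ω) : ℝ :=
  Finset.univ.inf' Finset.univ_nonempty fun k => headDist n (T k ω) ϑ / (2 * c)

lemma measurable_minHeadDist [MeasurableSpace Ω] (c : ℝ) (n : ℕ) {T : ι → Ω → Fin D → ℝ} (hT : ∀ k, Measurable (T k))
    (ϑ : Fin D → ℝ) : Measurable (minHeadDist c n T ϑ) := by
  have h : Measurable fun ω => ⨅ k, headDist n (T k ω) ϑ / (2 * c) :=
    Measurable.iInf fun k => ((measurable_headDist n ϑ).comp (hT k)).div_const _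
  convert h using 2
  rw [minHeadDist, Finset.inf'_univ_eq_ciInf]

lemma minHeadDist_nonneg {c : ℝ} (hc : 0 < c) (n : ℕ) (T : ι → Ω → Fin D → ℝ) (ϑ : Fin D → ℝ)
    (ω : Ω) : 0 ≤ minHeadDist c n T ϑ ω :=
  (Finset.le_inf'_iff _ _).2 fun _ _ => div_nonneg (headDist_nonneg _ _ _) (by positivity)

lemma exists_headDist_eq {c : ℝ} (hc : 0 < c) (n : ℕ) (T : ι → Ω → Fin D → ℝ) (ϑ : Fin D → ℝ)
    (ω : Ω) : ∃ k, headDist n (T k ω) ϑ = 2 * c * minHeadDist c n T ϑ ω := by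
  obtain ⟨k, -, hk⟩ := Finset.exists_mem_eq_inf' Finset.univ_nonempty
    fun k => headDist n (T k ω) ϑ / (2 * c)
  refine ⟨k, ?_⟩
  rw [minHeadDist, hk]
  field_simp

/-- By independence all vectors miss the ball with probability at most (1 - t^n)^K ≤ exp(-K t^n). -/
lemma measure_lt_minHeadDist_le [MeasurableSpace Ω] {P : Measure Ω} [IsProbabilityMeasure P]
    {c : ℝ} (hc : 0 < c)
    {T : ι → Ω → Fin D → ℝ} (hTm : ∀ k, Measurable (T k)) (hTi : iIndepFun T P)
    (hT : ∀ k, pdf.IsUniform (T k) (cube D (-c) c) P volume) {ϑ : Fin D → ℝ}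
    (hϑ : ϑ ∈ cube D (-c) c) {n : ℕ} {t : ℝ} (ht0 : 0 ≤ t) :
    P {ω | t < minHeadDist c n T ϑ ω}
      ≤ ENNReal.ofReal (1 * Real.exp (-(Fintype.card ι : ℝ) * t ^ n)) := by
  have hset : ∀ t : ℝ, {ω | t < minHeadDist c n T ϑ ω}
      = ⋂ k ∈ (Finset.univ : Finset ι), T k ⁻¹' {θ | 2 * c * t < headDist n θ ϑ} := fun t => by
    ext ω
    simp only [minHeadDist, Set.mem_ofPred_eq, Finset.lt_inf'_iff, Finset.mem_univ, true_implies,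
      Set.iInter_true, Set.mem_iInter, Set.mem_preimage]
    refine forall_congr' fun k => ?_
    rw [lt_div_iff₀ (by positivity), mul_comm]
  have hmeas : ∀ t : ℝ, MeasurableSet {θ : Fin D → ℝ | 2 * c * t < headDist n θ ϑ} := fun t =>
    measurableSet_lt measurable_const (measurable_headDist n ϑ)
  have hprob : ∀ t : ℝ, 0 ≤ t → t ≤ 1 → P {ω | t < minHeadDist c n T ϑ ω}
      ≤ ENNReal.ofReal (1 - t ^ n) ^ Fintype.card ι := fun t ht0 ht1 => by
    rw [hset, hTi.measure_inter_preimage_eq_mul _ fun _ _ => hmeas t]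
    refine (Finset.prod_le_pow_card _ _ _ fun k _ => ?_).trans_eq (by rw [Finset.card_univ])
    have h1 := le_measure_headDist_le hc (hT k) hϑ n ht0 ht1
    have h2 : T k ⁻¹' {θ | 2 * c * t < headDist n θ ϑ}
        = {ω | headDist n (T k ω) ϑ ≤ 2 * c * t}ᶜ := by
      ext ω; simp
    have h3 : MeasurableSet {ω | headDist n (T k ω) ϑ ≤ 2 * c * t} :=
      measurableSet_le ((measurable_headDist n ϑ).comp (hTm k)) measurable_const
    rw [h2, prob_compl_eq_one_sub h3,
      ENNReal.ofReal_sub _ (by positivity), ENNReal.ofReal_one]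
    exact tsub_le_tsub_left h1 _
  rcases le_total t 1 with ht1 | ht1
  · refine (hprob t ht0 ht1).trans ?_
    have h1 : 0 ≤ 1 - t ^ n := sub_nonneg.2 (pow_le_one₀ ht0 ht1)
    rw [← ENNReal.ofReal_pow h1]
    refine ENNReal.ofReal_le_ofReal ?_
    have h2 : 1 - t ^ n ≤ Real.exp (-t ^ n) := by
      have := Real.add_one_le_exp (-t ^ n)
      linarith
    calc (1 - t ^ n) ^ Fintype.card ι ≤ Real.exp (-t ^ n) ^ Fintype.card ι := by gcongr
      _ = _ := by rw [← Real.exp_nat_mul, one_mul]; congr 1; ring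
  -- For `t ≥ 1` the event lies in the one for `t = 1`, whose bound is 0^K = 0.
  · have h0 := hprob 1 zero_le_one le_rfl
    simp only [one_pow, sub_self, ENNReal.ofReal_zero, ne_eq, Fintype.card_ne_zero,
      not_false_eq_true, zero_pow, nonpos_iff_eq_zero] at h0
    refine (measure_mono_null (fun ω hω => ?_) h0).trans_le zero_le
    exact lt_of_le_of_lt ht1 hω

/-- The tail bound is applied with moment order `n * m`, where `m = ⌈q / n⌉`, giving (m/K)^(1/n)
with `m ≤ q`. The free `s ≥ n` allows the parameter count to be replaced by L W². -/
lemma eLpNorm_minHeadDist_le [MeasurableSpace Ω] {P : Measure Ω} [IsProbabilityMeasure P]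
    {c : ℝ} (hc : 0 < c)
    {T : ι → Ω → Fin D → ℝ} (hTm : ∀ k, Measurable (T k)) (hTi : iIndepFun T P)
    (hT : ∀ k, pdf.IsUniform (T k) (cube D (-c) c) P volume) {ϑ : Fin D → ℝ}
    (hϑ : ϑ ∈ cube D (-c) c) {n : ℕ} (hn : 2 ≤ n) {q s : ℝ} (hq : 1 ≤ q) (hns : n ≤ s) :
    eLpNorm (minHeadDist c n T ϑ) (ENNReal.ofReal q) P
      ≤ ENNReal.ofReal (q / (Fintype.card ι : ℝ) ^ s⁻¹) := by
  have hn' : (2 : ℝ) ≤ n := by exact_mod_cast hn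
  have hK : (1 : ℝ) ≤ Fintype.card ι := by exact_mod_cast Fintype.card_pos (α := ι)
  set m := ⌈q / n⌉₊ with hm
  have hm0 : 0 < m := Nat.ceil_pos.2 (by positivity)
  have hm1 : (1 : ℝ) ≤ m := by exact_mod_cast hm0
  have hqm : q ≤ n * m := by
    have := Nat.le_ceil (q / n)
    rw [div_le_iff₀ (by positivity)] at this
    linarith
  have hmq : (m : ℝ) ≤ q := by
    rcases le_total q n with h | h
    · have : m ≤ 1 := Nat.ceil_le.2 (by rw [Nat.cast_one]; exact div_le_one_of_le₀ h (by positivity))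
      have : (m : ℝ) ≤ 1 := by exact_mod_cast this
      linarith
    · have h1 := Nat.ceil_lt_add_one (a := q / n) (by positivity)
      have h2 : q / n ≤ q / 2 := by gcongr
      linarith
  refine (eLpNorm_le_eLpNorm_of_exponent_le (ENNReal.ofReal_le_ofReal hqm)
    (measurable_minHeadDist c n hTm ϑ).aestronglyMeasurable).trans ?_
  refine (eLpNorm_le_of_tail (measurable_minHeadDist c n hTm ϑ) (minHeadDist_nonneg hc n T ϑ)
    (by omega) hm0 zero_le_one (by linarith : (0 : ℝ) < Fintype.card ι)
    fun t ht => measure_lt_minHeadDist_le hc hTm hTi hT hϑ ht).trans ?_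
  refine ENNReal.ofReal_le_ofReal ?_
  rw [Real.one_rpow, one_mul, Real.div_rpow (by positivity) (by positivity)]
  have h1 : (m : ℝ) ^ (1 / (n : ℝ)) ≤ q := by
    refine (Real.rpow_le_rpow_of_exponent_le hm1 ?_).trans_eq (Real.rpow_one _) |>.trans hmq
    rw [div_le_one (by positivity)]
    linarith
  have h2 : (Fintype.card ι : ℝ) ^ s⁻¹ ≤ (Fintype.card ι : ℝ) ^ (1 / (n : ℝ)) := by
    refine Real.rpow_le_rpow_of_exponent_le hK ?_
    rw [one_div]
    exact inv_anti₀ (by positivity) hns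
  gcongr

end RandomSearch

/-! ### Hoeffding's inequality -/

section Hoeffding

variable {Ω ι : Type*} [MeasurableSpace Ω] {P : Measure Ω} [IsProbabilityMeasure P] [Fintype ι]

/-- A centred variable with values in an interval of length `hi - lo` is sub-Gaussian with variance
proxy ((hi-lo)/2)². The interval is general so that the bound applies to both `g` and `-g`. -/
lemma measure_le_sum_sub_le {g : ι → Ω → ℝ} {lo hi : ℝ} (hlh : lo < hi)
    (hgm : ∀ i, Measurable (g i)) (hg : ∀ i ω, g i ω ∈ Set.Icc lo hi) (hgi : iIndepFun g P)
    {t : ℝ} (ht : 0 ≤ t) :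
    P.real {ω | t * Fintype.card ι ≤ ∑ i, (g i ω - ∫ ω', g i ω' ∂P)}
      ≤ Real.exp (-(2 * Fintype.card ι / (hi - lo) ^ 2) * t ^ 2) := by
  have hind : iIndepFun (fun i ω => g i ω - ∫ ω', g i ω' ∂P) P :=
    hgi.comp (fun i x => x - ∫ ω', g i ω' ∂P) fun i => measurable_id.sub_const _
  refine (HasSubgaussianMGF.measure_sum_ge_le_of_iIndepFun hind (s := Finset.univ)
    (c := fun _ => (‖hi - lo‖₊ / 2) ^ 2) (fun i _ => hasSubgaussianMGF_of_mem_Icc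
      (hgm i).aemeasurable (ae_of_all _ (hg i))) (by positivity)).trans (le_of_eq ?_)
  have h : 0 < hi - lo := sub_pos.2 hlh
  congr 1
  simp only [Finset.sum_const, Finset.card_univ, nsmul_eq_mul]
  push_cast
  rw [Real.norm_of_nonneg h.le]
  rcases Nat.eq_zero_or_pos (Fintype.card ι) with h0 | h0
  · simp [h0]
  · have : (0 : ℝ) < Fintype.card ι := by exact_mod_cast h0
    field_simp

/-- The deviation of the empirical mean from the expectation. -/
lemma measure_lt_abs_mean_sub_le [Nonempty ι] {g : ι → Ω → ℝ} {B μ : ℝ} (hB : 0 < B)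
    (hgm : ∀ i, Measurable (g i)) (hg : ∀ i ω, g i ω ∈ Set.Icc 0 B) (hgi : iIndepFun g P)
    (hμ : ∀ i, ∫ ω, g i ω ∂P = μ) {t : ℝ} (ht : 0 ≤ t) :
    P {ω | t < |1 / (Fintype.card ι : ℝ) * ∑ i, g i ω - μ|}
      ≤ ENNReal.ofReal (2 * Real.exp (-(2 * Fintype.card ι / B ^ 2) * t ^ 2)) := by
  have hM : (0 : ℝ) < Fintype.card ι := by exact_mod_cast Fintype.card_pos (α := ι)
  have h1 := measure_le_sum_sub_le hB hgm hg hgi ht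
  have h2 := measure_le_sum_sub_le (g := fun i ω => -g i ω) (neg_lt_zero.2 hB)
    (fun i => (hgm i).neg) (fun i ω => ⟨neg_le_neg (hg i ω).2, by simpa using (hg i ω).1⟩)
    (hgi.comp (fun _ x => -x) fun _ => measurable_neg) ht
  simp only [integral_neg, hμ, sub_zero, zero_sub, neg_neg] at h1 h2
  rw [← ofReal_measureReal]
  refine ENNReal.ofReal_le_ofReal ?_
  rw [two_mul]
  refine (measureReal_mono ?_ (measure_ne_top _ _)).trans
    ((measureReal_union_le _ _).trans (add_le_add h1 h2))
  intro ω hω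
  have hsum : 1 / (Fintype.card ι : ℝ) * ∑ i, g i ω - μ
      = (∑ i, (g i ω - μ)) / Fintype.card ι := by
    rw [Finset.sum_sub_distrib, Finset.sum_const, Finset.card_univ, nsmul_eq_mul]
    field_simp
  rw [Set.mem_ofPred_eq, hsum, lt_abs] at hω
  rcases hω with h | h
  · left
    rw [lt_div_iff₀ hM] at h
    exact h.le
  · right
    rw [← neg_div, lt_div_iff₀ hM, ← Finset.sum_neg_distrib] at h
    simp only [neg_sub] at h
    simpa [neg_add_eq_sub] using h.le

end Hoeffding

/-! ### Moments of finite maxima -/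

section Maximum

variable {Ω I : Type*} [MeasurableSpace Ω] {P : Measure Ω} [IsProbabilityMeasure P] [Fintype I]
  [Nonempty I]

/-- A maximal inequality for finitely many random variables with sub-Gaussian tails. -/
lemma eLpNorm_sup'_le {F : I → Ω → ℝ} (hFm : ∀ i, Measurable (F i)) (hF0 : ∀ i ω, 0 ≤ F i ω)
    {κ : ℝ} (hκ : 0 < κ)
    (hF : ∀ i t, 0 ≤ t → P {ω | t < F i ω} ≤ ENNReal.ofReal (2 * Real.exp (-κ * t ^ 2)))
    {q S : ℝ} (hqS : q / 2 + 1 ≤ S) (hq : 0 < q)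
    (hIS : Real.log (2 * Fintype.card I) + 1 ≤ S) :
    eLpNorm (fun ω => Finset.univ.sup' Finset.univ_nonempty fun i => F i ω) (ENNReal.ofReal q) P
      ≤ ENNReal.ofReal (2 * √(S / κ)) := by
  have hI : (1 : ℝ) ≤ Fintype.card I := by exact_mod_cast Fintype.card_pos (α := I)
  set Z : Ω → ℝ := fun ω => Finset.univ.sup' Finset.univ_nonempty fun i => F i ω with hZ
  have hZm : Measurable Z := by
    have h : Measurable fun ω => ⨆ i, F i ω := Measurable.iSup hFm
    simpa only [hZ, Finset.sup'_univ_eq_ciSup] using h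
  have hZ0 : ∀ ω, 0 ≤ Z ω := fun ω => by
    obtain ⟨i⟩ := ‹Nonempty I›
    exact (hF0 i ω).trans (Finset.le_sup' (fun i => F i ω) (Finset.mem_univ i))
  have htail : ∀ t, 0 ≤ t → P {ω | t < Z ω}
      ≤ ENNReal.ofReal (2 * Fintype.card I * Real.exp (-κ * t ^ 2)) := fun t ht => by
    have hsub : {ω | t < Z ω} ⊆ ⋃ i ∈ (Finset.univ : Finset I), {ω | t < F i ω} := fun ω hω => by
      simpa [hZ, Finset.lt_sup'_iff] using hω
    refine (measure_mono hsub).trans ((measure_biUnion_finset_le _ _).trans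
      ((Finset.sum_le_card_nsmul _ _ _ fun i _ => hF i t ht).trans (le_of_eq ?_)))
    rw [Finset.card_univ, nsmul_eq_mul, ← ENNReal.ofReal_natCast,
      ← ENNReal.ofReal_mul (Nat.cast_nonneg _)]
    congr 1; ring
  -- `2 * m ≥ q` allows monotonicity of the norms, and m ≥ log(2|I|) makes the prefactor
  -- (2|I|)^(1/(2m)) at most e^(1/2) < 2.
  set m := ⌈max (q / 2) (Real.log (2 * Fintype.card I))⌉₊ with hm
  have hm0 : 0 < m := Nat.ceil_pos.2 (lt_max_of_lt_left (by positivity))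
  have hm' : (0 : ℝ) < m := by exact_mod_cast hm0
  have hm1 : max (q / 2) (Real.log (2 * Fintype.card I)) ≤ m := Nat.le_ceil _
  have hmS : (m : ℝ) ≤ S := by
    refine (Nat.ceil_lt_add_one (le_max_of_le_left (by positivity))).le.trans ?_
    rw [← max_add_add_right]
    exact max_le hqS hIS
  have hqm : q ≤ (2 : ℕ) * m := by
    have := (le_max_left _ _).trans hm1
    push_cast
    linarith
  refine (eLpNorm_le_eLpNorm_of_exponent_le (ENNReal.ofReal_le_ofReal hqm)
    hZm.aestronglyMeasurable).trans ((eLpNorm_le_of_tail hZm hZ0 two_pos hm0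
      (by positivity) hκ htail).trans (ENNReal.ofReal_le_ofReal ?_))
  have h1 : (2 * (Fintype.card I : ℝ)) ^ (1 / (((2 : ℕ) : ℝ) * m)) ≤ 2 := by
    have hpos : (0 : ℝ) < 2 * Fintype.card I := by positivity
    rw [Real.rpow_def_of_pos hpos]
    have h2 : Real.log (2 * Fintype.card I) * (1 / (((2 : ℕ) : ℝ) * m)) ≤ 1 / 2 := by
      have := (le_max_right _ _).trans hm1
      rw [mul_one_div, div_le_iff₀ (by positivity)]
      push_cast
      linarith
    refine (Real.exp_le_exp.2 h2).trans ?_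
    have h3 : Real.exp (1 / 2) ^ 2 = Real.exp 1 := by
      rw [← Real.exp_nat_mul]; norm_num
    have h4 := Real.exp_one_lt_d9
    nlinarith [Real.exp_pos (1 / 2)]
  have h5 : ((m : ℝ) / κ) ^ (1 / ((2 : ℕ) : ℝ)) ≤ √(S / κ) := by
    rw [Real.sqrt_eq_rpow]
    push_cast
    gcongr
  gcongr

end Maximum

/-! ### A grid in the parameter ball -/

section Grid

variable {D : ℕ}

/-- The point with index `j` of a grid with `N ^ n` points in `[-β, β]^n`, extended by zero. -/
noncomputable def gridPoint (D : ℕ) (β : ℝ) {n N : ℕ} (j : Fin n → Fin N) : Fin D → ℝ :=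
  fun i => if h : (i : ℕ) < n then -β + (2 * (j ⟨i, h⟩ : ℕ) + 1) * (β / N) else 0

lemma norm_gridPoint_le {β : ℝ} (hβ : 0 ≤ β) {n N : ℕ} (j : Fin n → Fin N) :
    ‖gridPoint D β j‖ ≤ β := by
  refine (pi_norm_le_iff_of_nonneg hβ).2 fun i => ?_
  unfold gridPoint
  split_ifs with h
  · have h1 : ((j ⟨i, h⟩ : ℕ) : ℝ) + 1 ≤ N := by exact_mod_cast (j ⟨i, h⟩).2
    have hN : (0 : ℝ) < N := lt_of_lt_of_le (by positivity) h1
    have h2 : (N : ℝ) * (β / N) = β := by field_simp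
    have h3 : 0 ≤ β / N := by positivity
    rw [Real.norm_eq_abs, abs_le]
    constructor
    · have : 0 ≤ (2 * ((j ⟨i, h⟩ : ℕ) : ℝ) + 1) * (β / N) := by positivity
      linarith
    · nlinarith
  · simpa using hβ

/-- The grid values are the midpoints of `N` intervals of length 2β/N that tile [-β,β]. -/
lemma exists_abs_sub_grid_le {β : ℝ} (hβ : 0 < β) {N : ℕ} (hN : 0 < N) {y : ℝ} (hy : |y| ≤ β) :
    ∃ j : Fin N, |y - (-β + (2 * (j : ℕ) + 1) * (β / N))| ≤ β / N := by
  have hN' : (0 : ℝ) < N := by exact_mod_cast hN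
  rw [abs_le] at hy
  set h := β / N with hh
  have hpos : 0 < h := by positivity
  have hNh : (N : ℝ) * h = β := by rw [hh]; field_simp
  set z := (y + β) / (2 * h) with hz
  have hz0 : 0 ≤ z := div_nonneg (by linarith) (by positivity)
  have hzy : z * (2 * h) = y + β := by rw [hz]; field_simp
  have hzN : z ≤ N := by rw [hz, div_le_iff₀ (by positivity)]; nlinarith
  rcases lt_or_ge ⌊z⌋₊ N with hlt | hge
  · refine ⟨⟨⌊z⌋₊, hlt⟩, ?_⟩
    have h1 := Nat.floor_le hz0
    have h2 := Nat.lt_floor_add_one z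
    rw [abs_le]
    constructor <;> dsimp only <;> nlinarith
  -- Only `y = β` remains; its index would be `N`, but it is an endpoint of the last interval.
  · refine ⟨⟨N - 1, by omega⟩, ?_⟩
    have h1 : (N : ℝ) ≤ z := (Nat.cast_le.2 hge).trans (Nat.floor_le hz0)
    have h2 : ((N - 1 : ℕ) : ℝ) = N - 1 := by rw [Nat.cast_sub hN]; simp
    have h3 : z = N := le_antisymm hzN h1
    rw [h3] at hzy
    rw [abs_le]
    dsimp only
    rw [h2]
    constructor <;> nlinarith

lemma exists_gridPoint_near {β : ℝ} (hβ : 0 < β) {n N : ℕ} (hn : n ≤ D) (hN : 0 < N)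
    {θ : Fin D → ℝ} (hθ : ‖θ‖ ≤ β) :
    ∃ j : Fin n → Fin N, ∀ i < n, |entry θ i - entry (gridPoint D β j) i| ≤ β / N := by
  have := fun i : Fin n => exists_abs_sub_grid_le hβ hN
    ((norm_le_pi_norm θ (Fin.castLE hn i)).trans hθ)
  choose j hj using this
  refine ⟨j, fun i hi => ?_⟩
  have hiD : i < D := hi.trans_le hn
  simpa [entry, gridPoint, hiD, hi] using hj ⟨i, hi⟩

end Grid

/-! ### Risk, empirical risk and the regression function -/

section Risk

variable {Ω S ι : Type*} {u v : ℝ}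

/-- Makes the squared loss Lipschitz on [u,v], so that uniformly close networks have close risks,
empirical or not. -/
lemma abs_sq_sub_sub_sq_sub_le {x y z : ℝ} (hx : x ∈ Set.Icc u v) (hy : y ∈ Set.Icc u v)
    (hz : z ∈ Set.Icc u v) : |(x - z) ^ 2 - (y - z) ^ 2| ≤ 2 * (v - u) * |x - y| := by
  rw [show (x - z) ^ 2 - (y - z) ^ 2 = (x + y - 2 * z) * (x - y) by ring, abs_mul]
  gcongr
  rw [abs_le]
  constructor <;> linarith [hx.1, hx.2, hy.1, hy.2, hz.1, hz.2]

lemma sq_sub_mem_Icc {x z : ℝ} (hx : x ∈ Set.Icc u v) (hz : z ∈ Set.Icc u v) :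
    (x - z) ^ 2 ∈ Set.Icc 0 ((v - u) ^ 2) :=
  ⟨sq_nonneg _, sq_le_sq' (by linarith [hx.1, hz.2]) (by linarith [hx.2, hz.1])⟩

/-- The empirical mean square error of `f`. -/
noncomputable def empRisk [Fintype ι] (X : ι → Ω → S) (Y : ι → Ω → ℝ) (f : S → ℝ) (ω : Ω) : ℝ :=
  1 / (Fintype.card ι : ℝ) * ∑ j, (f (X j ω) - Y j ω) ^ 2

/-- The mean square error of `f`. -/
noncomputable def risk [MeasurableSpace Ω] (P : Measure Ω) (X : Ω → S) (Y : Ω → ℝ) (f : S → ℝ) :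
    ℝ := ∫ ω, (f (X ω) - Y ω) ^ 2 ∂P

lemma abs_empRisk_sub_le [Fintype ι] [Nonempty ι] {X : ι → Ω → S} {Y : ι → Ω → ℝ}
    (hY : ∀ j ω, Y j ω ∈ Set.Icc u v) (huv : u ≤ v) {f g : S → ℝ} (hf : ∀ x, f x ∈ Set.Icc u v)
    (hg : ∀ x, g x ∈ Set.Icc u v) {δ : ℝ} (hfg : ∀ x, |f x - g x| ≤ δ) (ω : Ω) :
    |empRisk X Y f ω - empRisk X Y g ω| ≤ 2 * (v - u) * δ := by
  have hM : (0 : ℝ) < Fintype.card ι := by exact_mod_cast Fintype.card_pos (α := ι)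
  have huv' : 0 ≤ v - u := sub_nonneg.2 huv
  rw [empRisk, empRisk, ← mul_sub, ← Finset.sum_sub_distrib, abs_mul, abs_of_pos (by positivity)]
  have h : |∑ j, ((f (X j ω) - Y j ω) ^ 2 - (g (X j ω) - Y j ω) ^ 2)|
      ≤ ∑ _j : ι, 2 * (v - u) * δ := by
    refine (Finset.abs_sum_le_sum_abs _ _).trans (Finset.sum_le_sum fun j _ => ?_)
    refine (abs_sq_sub_sub_sq_sub_le (hf _) (hg _) (hY j ω)).trans ?_
    gcongr
    exact hfg _
  rw [Finset.sum_const, Finset.card_univ, nsmul_eq_mul] at h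
  rw [one_div, inv_mul_le_iff₀ hM]
  exact h

variable [MeasurableSpace Ω] [MeasurableSpace S] {P : Measure Ω} [IsProbabilityMeasure P]

lemma integrable_of_measurable_of_mem_Icc {g : Ω → ℝ} (hg : Measurable g) {lo hi : ℝ}
    (h : ∀ ω, g ω ∈ Set.Icc lo hi) : Integrable g P :=
  Integrable.of_mem_Icc lo hi hg.aemeasurable (ae_of_all _ h)

lemma abs_risk_sub_le {X : Ω → S} {Y : Ω → ℝ} (hX : Measurable X) (hYm : Measurable Y)
    (hY : ∀ ω, Y ω ∈ Set.Icc u v) (huv : u ≤ v) {f g : S → ℝ} (hfm : Measurable f)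
    (hgm : Measurable g) (hf : ∀ x, f x ∈ Set.Icc u v)
    (hg : ∀ x, g x ∈ Set.Icc u v) {δ : ℝ} (hfg : ∀ x, |f x - g x| ≤ δ) :
    |risk P X Y f - risk P X Y g| ≤ 2 * (v - u) * δ := by
  have huv' : 0 ≤ v - u := sub_nonneg.2 huv
  have hint : ∀ h : S → ℝ, Measurable h → (∀ x, h x ∈ Set.Icc u v) →
      Integrable (fun ω => (h (X ω) - Y ω) ^ 2) P := fun h hm hh =>
    integrable_of_measurable_of_mem_Icc (((hm.comp hX).sub hYm).pow_const 2)
      fun ω => sq_sub_mem_Icc (hh _) (hY ω)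
  rw [risk, risk, ← integral_sub (hint f hfm hf) (hint g hgm hg), ← Real.norm_eq_abs]
  refine (norm_integral_le_of_norm_le_const (C := 2 * (v - u) * δ)
    (ae_of_all _ fun ω => ?_)).trans_eq (by simp)
  refine (abs_sq_sub_sub_sq_sub_le (hf _) (hg _) (hY ω)).trans ?_
  gcongr
  exact hfg _

/-- The concentration of the empirical risk around the risk. -/
lemma measure_lt_abs_empRisk_sub_risk_le [Fintype ι] [Nonempty ι] {X : ι → Ω → S} {Y : ι → Ω → ℝ}
    (hX : ∀ j, Measurable (X j)) (hYm : ∀ j, Measurable (Y j)) (hY : ∀ j ω, Y j ω ∈ Set.Icc u v)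
    (hind : iIndepFun (fun j ω => (X j ω, Y j ω)) P) (i : ι)
    (hident : ∀ j, IdentDistrib (fun ω => (X j ω, Y j ω)) (fun ω => (X i ω, Y i ω)) P P)
    (huv : u < v) {f : S → ℝ} (hfm : Measurable f) (hf : ∀ x, f x ∈ Set.Icc u v) {t : ℝ}
    (ht : 0 ≤ t) :
    P {ω | t < |empRisk X Y f ω - risk P (X i) (Y i) f|} ≤ ENNReal.ofReal
      (2 * Real.exp (-(2 * Fintype.card ι / ((v - u) ^ 2) ^ 2) * t ^ 2)) := by
  have hφ : Measurable fun z : S × ℝ => (f z.1 - z.2) ^ 2 :=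
    ((hfm.comp measurable_fst).sub measurable_snd).pow_const 2
  have huv' : 0 < v - u := sub_pos.2 huv
  exact measure_lt_abs_mean_sub_le (g := fun j ω => (f (X j ω) - Y j ω) ^ 2) (by positivity)
    (fun j => hφ.comp ((hX j).prodMk (hYm j))) (fun j ω => sq_sub_mem_Icc (hf _) (hY j ω))
    (hind.comp (fun _ z => (f z.1 - z.2) ^ 2) fun _ => hφ)
    (fun j => ((hident j).comp hφ).integral_eq) ht

/-- The bias-variance decomposition. -/
lemma integral_sq_sub_regression {X : Ω → S} {Y : Ω → ℝ} (hX : Measurable X) (hYm : Measurable Y)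
    (hY : ∀ ω, Y ω ∈ Set.Icc u v) {f E : S → ℝ} (hfm : Measurable f) (hEm : Measurable E)
    (hf : ∀ x, f x ∈ Set.Icc u v) (hE : ∀ x, E x ∈ Set.Icc u v)
    (hcond : (fun ω => E (X ω)) =ᵐ[P] P[Y | MeasurableSpace.comap X inferInstance]) :
    ∫ ω, (f (X ω) - E (X ω)) ^ 2 ∂P = risk P X Y f - risk P X Y E := by
  have hfX := hfm.comp hX
  have hEX := hEm.comp hX
  have hg : Measurable fun ω => f (X ω) - E (X ω) := hfX.sub hEX
  have hgI : ∀ ω, f (X ω) - E (X ω) ∈ Set.Icc (u - v) (v - u) := fun ω =>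
    ⟨by linarith [(hf (X ω)).1, (hE (X ω)).2], by linarith [(hf (X ω)).2, (hE (X ω)).1]⟩
  have hYi : Integrable Y P := integrable_of_measurable_of_mem_Icc hYm hY
  have hEi : Integrable (fun ω => E (X ω)) P := integrable_of_measurable_of_mem_Icc hEX
    fun ω => hE _
  have hbd : ∀ᵐ ω ∂P, ‖f (X ω) - E (X ω)‖ ≤ v - u := ae_of_all _ fun ω =>
    abs_le.2 ⟨by linarith [(hgI ω).1], (hgI ω).2⟩
  have hgY : Integrable ((fun ω => f (X ω) - E (X ω)) * Y) P :=
    hYi.bdd_mul hg.aestronglyMeasurable hbd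
  have hgE : Integrable (fun ω => (f (X ω) - E (X ω)) * E (X ω)) P :=
    hEi.bdd_mul hg.aestronglyMeasurable hbd
  have hgm : StronglyMeasurable[MeasurableSpace.comap X inferInstance]
      fun ω => f (X ω) - E (X ω) :=
    ((hfm.sub hEm).comp (comap_measurable X)).stronglyMeasurable
  -- f(X) − E(X) is σ(X)-measurable, so it can be pulled out of the conditional expectation of `Y`.
  have hcross : ∫ ω, (f (X ω) - E (X ω)) * Y ω ∂P = ∫ ω, (f (X ω) - E (X ω)) * E (X ω) ∂P := by
    have h1 := condExp_mul_of_aestronglyMeasurable_left (μ := P) hgm.aestronglyMeasurable hgY hYi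
    have h2 := integral_condExp (μ := P) hX.comap_le (f := (fun ω => f (X ω) - E (X ω)) * Y)
    rw [show (∫ ω, (f (X ω) - E (X ω)) * Y ω ∂P)
      = ∫ ω, ((fun ω => f (X ω) - E (X ω)) * Y) ω ∂P from rfl, ← h2]
    refine integral_congr_ae ?_
    filter_upwards [h1, hcond] with ω h3 h4
    rw [h3, Pi.mul_apply, ← h4]
  have i1 : Integrable (fun ω => (f (X ω) - E (X ω)) ^ 2) P :=
    integrable_of_measurable_of_mem_Icc (hg.pow_const 2) fun ω => sq_sub_mem_Icc (hf _) (hE _)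
  have i2 : Integrable (fun ω => (f (X ω) - Y ω) ^ 2) P :=
    integrable_of_measurable_of_mem_Icc ((hfX.sub hYm).pow_const 2)
      fun ω => sq_sub_mem_Icc (hf _) (hY _)
  have i3 : Integrable (fun ω => (E (X ω) - Y ω) ^ 2) P :=
    integrable_of_measurable_of_mem_Icc ((hEX.sub hYm).pow_const 2)
      fun ω => sq_sub_mem_Icc (hE _) (hY _)
  have hgY' : Integrable (fun ω => (f (X ω) - E (X ω)) * Y ω) P := hgY
  rw [risk, risk, ← integral_sub i2 i3]
  -- Adding this zero reduces the claim to the pointwise identity (f−E)² + 2(f−E)(E−Y) = (f−Y)² −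
  -- (E−Y)².
  have hzero : ∫ ω, 2 * ((f (X ω) - E (X ω)) * E (X ω) - (f (X ω) - E (X ω)) * Y ω) ∂P = 0 := by
    rw [integral_const_mul, integral_sub hgE hgY', hcross, sub_self, mul_zero]
  have i4 : Integrable
      (fun ω => 2 * ((f (X ω) - E (X ω)) * E (X ω) - (f (X ω) - E (X ω)) * Y ω)) P :=
    (hgE.sub hgY').const_mul 2
  rw [← add_zero (∫ ω, (f (X ω) - E (X ω)) ^ 2 ∂P), ← hzero, ← integral_add i1 i4]
  refine integral_congr_ae (ae_of_all _ fun ω => ?_)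
  dsimp only
  ring

end Risk

/-! ### Numerical estimates for the constants -/

section Numerics

/-- The term L·Λ pays for the powers of M, β, c and for the factor 2 lost in rounding up (hence the
4 in the logarithm), while log L ≤ L − 1 and log W ≤ W − 1 give L·W − 1. Multiplication by n ≤ L W²
and Λ + W ≤ 2WΛ give the result. -/
lemma log_card_grid_le {L n M : ℕ} (hL : 0 < L) (hM : 0 < M) (hn : 2 ≤ n) {W c β Λ : ℝ}
    (hW : 2 ≤ W) (hnW : n ≤ L * W ^ 2) (hc : 1 ≤ c) (hβ : 1 ≤ β) (hΛ1 : 1 ≤ Λ)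
    (hΛ : Real.log (4 * M * β * c) ≤ Λ) :
    Real.log (2 * (⌈c * L * W ^ L * β ^ L * √M⌉₊ : ℝ) ^ n) + 1
      ≤ 2 * (L : ℝ) ^ 2 * W ^ 3 * Λ ^ 2 := by
  have hL' : (1 : ℝ) ≤ L := by exact_mod_cast hL
  have hM' : (1 : ℝ) ≤ M := by exact_mod_cast hM
  have hn' : (2 : ℝ) ≤ n := by exact_mod_cast hn
  have hW0 : 0 < W := by linarith
  set x := c * L * W ^ L * β ^ L * √M with hx
  have hx1 : 1 ≤ x := by
    have h1 : 1 ≤ W ^ L := one_le_pow₀ (by linarith)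
    have h2 : 1 ≤ β ^ L := one_le_pow₀ hβ
    have h3 : 1 ≤ √(M : ℝ) := Real.one_le_sqrt.2 hM'
    exact one_le_mul_of_one_le_of_one_le (one_le_mul_of_one_le_of_one_le
      (one_le_mul_of_one_le_of_one_le (one_le_mul_of_one_le_of_one_le hc hL') h1) h2) h3
  have hN0 : (0 : ℝ) < ⌈x⌉₊ := by
    exact_mod_cast Nat.ceil_pos.2 (by linarith)
  have hN : (⌈x⌉₊ : ℝ) ≤ 2 * x := by
    have := (Nat.ceil_lt_add_one (a := x) (by linarith)).le
    linarith
  have hlogN : Real.log ⌈x⌉₊ ≤ L * Λ + L * W - 1 := by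
    refine (Real.log_le_log hN0 hN).trans ?_
    have e1 : Real.log (2 * x) = Real.log 2 + (Real.log c + Real.log L + L * Real.log W
        + L * Real.log β + Real.log M / 2) := by
      rw [hx, Real.log_mul (by positivity) (by positivity),
        Real.log_mul (by positivity) (by positivity),
        Real.log_mul (by positivity) (by positivity),
        Real.log_mul (by positivity) (by positivity),
        Real.log_mul (by positivity) (by positivity),
        Real.log_pow, Real.log_pow, Real.log_sqrt (by positivity)]
    have e2 : Real.log (4 * M * β * c) = 2 * Real.log 2 + Real.log M + Real.log β + Real.log c := by
      rw [Real.log_mul (by positivity) (by positivity),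
        Real.log_mul (by positivity) (by positivity),
        Real.log_mul (by positivity) (by positivity),
        show (4 : ℝ) = 2 ^ 2 by norm_num, Real.log_pow]
      push_cast; ring
    have a1 := Real.log_nonneg hM'
    have a2 := Real.log_nonneg hβ
    have a3 := Real.log_nonneg hc
    have a4 : 0 ≤ Real.log 2 := Real.log_nonneg (by norm_num)
    have a5 : Real.log L ≤ L - 1 := Real.log_le_sub_one_of_pos (by linarith)
    have a6 : Real.log W ≤ W - 1 := Real.log_le_sub_one_of_pos hW0
    have a7 : L * Real.log W ≤ L * (W - 1) := by gcongr
    have a8 : (L : ℝ) * (2 * Real.log 2 + Real.log M + Real.log β + Real.log c) ≤ L * Λ := by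
      rw [← e2]; gcongr
    have a9 : Real.log 2 ≤ L * (2 * Real.log 2) := by nlinarith
    have a10 : Real.log c ≤ L * Real.log c := by nlinarith
    have a11 : Real.log M / 2 ≤ L * Real.log M := by nlinarith
    rw [e1]
    linarith
  rw [Real.log_mul (by norm_num) (by positivity), Real.log_pow]
  have hlog2 : Real.log 2 ≤ 1 := by
    have := Real.log_le_sub_one_of_pos (x := 2) (by norm_num)
    linarith
  have b1 : (n : ℝ) * Real.log ⌈x⌉₊ ≤ n * (L * Λ + L * W - 1) := by gcongr
  have b2 : (n : ℝ) * (L * (Λ + W)) ≤ (L * W ^ 2) * (L * (Λ + W)) := by gcongr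
  have b3 : Λ + W ≤ 2 * W * Λ := by nlinarith
  have b4 : (L * W ^ 2) * (L * (Λ + W)) ≤ (L * W ^ 2) * (L * (2 * W * Λ)) := by gcongr
  have b5 : (L * W ^ 2) * (L * (2 * W * Λ)) * 1 ≤ (L * W ^ 2) * (L * (2 * W * Λ)) * Λ := by
    gcongr
  -- The `-1` in `b1`, multiplied by `n ≥ 2`, pays for `log 2 + 1`.
  calc Real.log 2 + n * Real.log ⌈x⌉₊ + 1 ≤ n * (L * (Λ + W)) := by linarith
    _ ≤ (L * W ^ 2) * (L * (2 * W * Λ)) * Λ := by linarith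
    _ = _ := by ring

/-- With y = L W^(3/2) Λ the left side is (8V + 4V²y)/√M. Since y ≥ 2 and V ≤ max(V,1)², both
summands are at most 4 max(V,1)² y, so 8 would do in place of 10. -/
lemma generalization_bound_le {L M : ℕ} (hL : 0 < L) {W V Λ : ℝ} (hW : 2 ≤ W) (hV : 0 < V)
    (hΛ1 : 1 ≤ Λ) :
    8 * V / √M + 2 * (2 * √((2 * (L : ℝ) ^ 2 * W ^ 3 * Λ ^ 2) / (2 * M / (V ^ 2) ^ 2)))
      ≤ 10 * max V 1 ^ 2 * L * W ^ (3 / 2 : ℝ) * Λ / √M := by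
  have hL' : (1 : ℝ) ≤ L := by exact_mod_cast hL
  have hW32 : (W ^ (3 / 2 : ℝ)) ^ 2 = W ^ 3 := by
    rw [← Real.rpow_natCast, ← Real.rpow_mul (by linarith), ← Real.rpow_natCast]
    norm_num
  have h1 : (2 * (L : ℝ) ^ 2 * W ^ 3 * Λ ^ 2) / (2 * M / (V ^ 2) ^ 2)
      = (V ^ 2 * L * W ^ (3 / 2 : ℝ) * Λ) ^ 2 / M := by
    rw [mul_pow, mul_pow, mul_pow, hW32]
    rcases Nat.eq_zero_or_pos M with h | h
    · simp [h]
    · have : (0 : ℝ) < M := by exact_mod_cast h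
      field_simp
  rw [h1, Real.sqrt_div (sq_nonneg _), Real.sqrt_sq (by positivity)]
  have h2 : 2 ≤ W ^ (3 / 2 : ℝ) := hW.trans (by
    conv_lhs => rw [← Real.rpow_one W]
    exact Real.rpow_le_rpow_of_exponent_le (by linarith) (by norm_num))
  have h3 : 2 ≤ L * W ^ (3 / 2 : ℝ) * Λ := by
    have : 1 * 2 ≤ L * W ^ (3 / 2 : ℝ) := by gcongr
    nlinarith
  set y := L * W ^ (3 / 2 : ℝ) * Λ with hy
  have h4 : V ≤ max V 1 ^ 2 := by nlinarith [le_max_left V 1, le_max_right V 1]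
  have h5 : V ^ 2 ≤ max V 1 ^ 2 := by gcongr; exact le_max_left _ _
  have h6 : V ^ 2 * L * W ^ (3 / 2 : ℝ) * Λ = V ^ 2 * y := by rw [hy]; ring
  have h7 : 10 * max V 1 ^ 2 * L * W ^ (3 / 2 : ℝ) * Λ = 10 * (max V 1 ^ 2 * y) := by rw [hy]; ring
  rw [h6, h7, show 8 * V / √M + 2 * (2 * (V ^ 2 * y / √M)) = (8 * V + 4 * (V ^ 2 * y)) / √M by ring]
  gcongr
  have h8 : V ^ 2 * y ≤ max V 1 ^ 2 * y := by gcongr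
  have h9 : V * 2 ≤ max V 1 ^ 2 * y := by gcongr
  linarith

end Numerics

/-! ### Specialization to the network class, measurability, Minkowski -/

section Assembly

variable {d D L : ℕ} {l : ℕ → ℕ} {h0 : l 0 = d} {hL1 : l L = 1} {a b u v c β : ℝ}

/-- The network reads only its first `numParams l L` entries, so the search rate depends on the
architecture and not on `D`. The bound `B` is free: it is `c` for the random search and `β` on the
grid. -/
lemma abs_realNetwork_sub_le_headDist {θ ϑ : Fin D → ℝ} {B : ℝ} (hB : 1 ≤ B)
    (hc : max 1 (max |a| |b|) ≤ c) (hθ : ‖θ‖ ≤ B) (hϑ : ‖ϑ‖ ≤ B) (x : cube d a b) :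
    |realNetwork L l h0 hL1 u v θ x - realNetwork L l h0 hL1 u v ϑ x|
      ≤ L * headDist (numParams l L) θ ϑ * c * ((width L l : ℝ) + 1) ^ L * B ^ (L - 1) := by
  refine abs_realNetwork_sub_le hB ((le_max_left _ _).trans hc) (headDist_nonneg _ _ _)
    (fun i _ => (abs_entry_le θ i).trans hθ) (fun i _ => (abs_entry_le ϑ i).trans hϑ)
    (fun i hi => abs_entry_sub_le_headDist θ ϑ hi) fun j => ?_
  have ha : |a| ≤ c := (le_max_left _ _).trans ((le_max_right _ _).trans hc)
  have hb : |b| ≤ c := (le_max_right _ _).trans ((le_max_right _ _).trans hc)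
  rw [abs_le] at ha hb ⊢
  exact ⟨ha.1.trans (x.2.1 j), (x.2.2 j).trans hb.2⟩

lemma norm_le_of_mem_cube (hc : 0 ≤ c) {θ : Fin D → ℝ} (h : θ ∈ cube D (-c) c) : ‖θ‖ ≤ c :=
  (pi_norm_le_iff_of_nonneg hc).2 fun i => abs_le.2 ⟨h.1 i, h.2 i⟩

lemma ae_mem_cube_of_isUniform {Ω : Type*} [MeasurableSpace Ω] {P : Measure Ω} (hc : 0 < c)
    {T : Ω → Fin D → ℝ} (hT : pdf.IsUniform T (cube D (-c) c) P volume) :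
    ∀ᵐ ω ∂P, T ω ∈ cube D (-c) c := by
  have hvol := volume_cube hc D
  have hpos : 0 < (2 * c) ^ D := by positivity
  have h := hT.measure_preimage (by rw [hvol]; exact (ENNReal.ofReal_pos.2 hpos).ne')
    (by rw [hvol]; exact ENNReal.ofReal_ne_top)
    (A := (cube D (-c) c)ᶜ) (measurableSet_Icc.compl)
  rw [Set.inter_compl_self, measure_empty, ENNReal.zero_div] at h
  exact h

/-- The squared `L²`-distance of a network to `E` depends measurably on the parameters. -/
lemma measurable_lintegral_realNetwork (ν : Measure (cube d a b)) [SFinite ν]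
    {E : cube d a b → Set.Icc u v} (hE : Measurable E) :
    Measurable fun θ : Fin D → ℝ => ∫⁻ x : cube d a b,
      ENNReal.ofReal (|realNetwork L l h0 hL1 u v θ x - (E x : ℝ)| ^ 2) ∂ν := by
  refine Measurable.lintegral_prod_right' (f := fun z : (Fin D → ℝ) × cube d a b =>
    ENNReal.ofReal (|realNetwork L l h0 hL1 u v z.1 z.2 - (E z.2 : ℝ)| ^ 2)) ?_
  have h1 : Continuous fun z : (Fin D → ℝ) × cube d a b =>
      realNetwork L l h0 hL1 u v z.1 (z.2 : Fin d → ℝ) :=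
    (continuous_realNetwork (h0 := h0) (hL := hL1)).comp (continuous_fst.prodMk (continuous_subtype_val.comp continuous_snd))
  have h2 : Measurable fun z : (Fin D → ℝ) × cube d a b => (E z.2 : ℝ) :=
    measurable_subtype_coe.comp (hE.comp measurable_snd)
  exact ((continuous_abs.measurable.comp (h1.measurable.sub h2)).pow_const 2).ennreal_ofReal

/-- Holds because the random index ranges over a countable set. -/
lemma measurable_apply_index {Ω : Type*} [MeasurableSpace Ω] {α : Type*} [MeasurableSpace α]
    {Θ : ℕ → ℕ → Ω → α} (hΘ : ∀ k n, Measurable (Θ k n)) {κ : Ω → ℕ × ℕ} (hκ : Measurable κ) :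
    Measurable fun ω => Θ (κ ω).1 (κ ω).2 ω := by
  have h : Measurable fun z : (ℕ × ℕ) × Ω => Θ z.1.1 z.1.2 z.2 :=
    measurable_from_prod_countable_right fun q => hΘ q.1 q.2
  exact h.comp (hκ.prodMk measurable_id)

variable {M : ℕ} {Ω : Type*}

/-- The deviations of the empirical risk from the risk on a finite grid control the deviations
on the whole ball. -/
lemma abs_empRisk_sub_risk_le [MeasurableSpace Ω] {P : Measure Ω} [IsProbabilityMeasure P]
    [Nonempty (Fin M)] (hLpos : 0 < L)
    (hc : max 1 (max |a| |b|) ≤ c) (hβ : c ≤ β) (huv : u < v) (hD : numParams l L ≤ D)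
    {X : Fin M → Ω → cube d a b} {Y : Fin M → Ω → ℝ} (hX : ∀ j, Measurable (X j))
    (hYm : ∀ j, Measurable (Y j)) (hY : ∀ j ω, Y j ω ∈ Set.Icc u v) (i : Fin M) {N : ℕ}
    (hN0 : 0 < N) (hN : c * L * ((width L l : ℝ) + 1) ^ L * β ^ L * √M ≤ N) {θ : Fin D → ℝ}
    (hθ : ‖θ‖ ≤ β) (ω : Ω) :
    ∃ j : Fin (numParams l L) → Fin N,
    |empRisk X Y (fun x => realNetwork L l h0 hL1 u v θ x) ω
        - risk P (X i) (Y i) (fun x => realNetwork L l h0 hL1 u v θ x)|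
      ≤ |empRisk X Y (fun x => realNetwork L l h0 hL1 u v (gridPoint D β j) x) ω
        - risk P (X i) (Y i) (fun x => realNetwork L l h0 hL1 u v (gridPoint D β j) x)|
        + 4 * (v - u) / √M := by
  have hc1 : 1 ≤ c := (le_max_left _ _).trans hc
  have hβ1 : 1 ≤ β := hc1.trans hβ
  have hM : (0 : ℝ) < M := by exact_mod_cast Fin.pos_iff_nonempty.2 ‹_›
  have hN' : (0 : ℝ) < N := by exact_mod_cast hN0
  obtain ⟨j, hj⟩ := exists_gridPoint_near (by linarith : 0 < β) hD hN0 hθ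
  refine ⟨j, ?_⟩
  set ϑ := gridPoint D β j
  have hϑ : ‖ϑ‖ ≤ β := norm_gridPoint_le (by linarith) j
  -- `N` is chosen so that mesh times Lipschitz constant is at most 1/√M. This shifts the empirical
  -- risk and the risk by 2(v−u)/√M each.
  have hδ : ∀ x : cube d a b, |realNetwork L l h0 hL1 u v θ x - realNetwork L l h0 hL1 u v ϑ x|
      ≤ 1 / √M := fun x => by
    refine (abs_realNetwork_sub_le_headDist hβ1 hc hθ hϑ x).trans ?_
    have h1 : headDist (numParams l L) θ ϑ ≤ β / N := headDist_le (by positivity) hj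
    calc (L : ℝ) * headDist (numParams l L) θ ϑ * c * ((width L l : ℝ) + 1) ^ L * β ^ (L - 1)
        ≤ L * (β / N) * c * ((width L l : ℝ) + 1) ^ L * β ^ (L - 1) := by gcongr
      _ = c * L * ((width L l : ℝ) + 1) ^ L * (β ^ (L - 1) * β) / N := by ring
      _ = c * L * ((width L l : ℝ) + 1) ^ L * β ^ L / N := by
          rw [← pow_succ, Nat.sub_add_cancel hLpos]
      _ ≤ 1 / √M := by
          rw [div_le_div_iff₀ hN' (by positivity), one_mul]
          exact hN
  have hmem : ∀ (θ : Fin D → ℝ) (x : cube d a b), realNetwork L l h0 hL1 u v θ x ∈ Set.Icc u v :=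
    fun θ x => realNetwork_mem_Icc (h0 := h0) (hL := hL1) hLpos huv.le θ x
  have hmeas : ∀ θ : Fin D → ℝ, Measurable fun x : cube d a b => realNetwork L l h0 hL1 u v θ x :=
    fun θ => ((continuous_realNetwork (h0 := h0) (hL := hL1)).comp
      (continuous_const.prodMk continuous_subtype_val)).measurable
  have h1 := abs_empRisk_sub_le (X := X) hY huv.le (hmem θ) (hmem ϑ) hδ ω
  have h2 := abs_risk_sub_le (P := P) (hX i) (hYm i) (hY i) huv.le (hmeas θ) (hmeas ϑ)
    (hmem θ) (hmem ϑ) hδ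
  rw [abs_le] at h1 h2
  have h3 : 4 * (v - u) / √M = 2 * (v - u) * (1 / √M) + 2 * (v - u) * (1 / √M) := by ring
  rw [h3, abs_le]
  have h4 := neg_abs_le (empRisk X Y (fun x => realNetwork L l h0 hL1 u v ϑ x) ω
        - risk P (X i) (Y i) (fun x => realNetwork L l h0 hL1 u v ϑ x))
  have h5 := le_abs_self (empRisk X Y (fun x => realNetwork L l h0 hL1 u v ϑ x) ω
        - risk P (X i) (Y i) (fun x => realNetwork L l h0 hL1 u v ϑ x))
  constructor <;> linarith

lemma measurable_empRisk [MeasurableSpace Ω] {S ι : Type*} [MeasurableSpace S] [Fintype ι]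
    {X : ι → Ω → S} {Y : ι → Ω → ℝ} (hX : ∀ j, Measurable (X j)) (hY : ∀ j, Measurable (Y j))
    {f : S → ℝ} (hf : Measurable f) : Measurable (empRisk X Y f) :=
  (Finset.measurable_fun_sum _ fun j _ => ((hf.comp (hX j)).sub (hY j)).pow_const 2).const_mul _

lemma eLpNorm_le_three [MeasurableSpace Ω] {P : Measure Ω} [IsProbabilityMeasure P]
    {f Z G : Ω → ℝ} (hZ : Measurable Z) (hG : Measurable G) {A B z g q : ℝ} (hA : 0 ≤ A)
    (hB : 0 ≤ B) (hz : 0 ≤ z) (hg : 0 ≤ g) (hq : 1 ≤ q)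
    (hf : ∀ᵐ ω ∂P, ‖f ω‖ ≤ A + B * Z ω + 2 * G ω)
    (hZq : eLpNorm Z (ENNReal.ofReal q) P ≤ ENNReal.ofReal z)
    (hGq : eLpNorm G (ENNReal.ofReal q) P ≤ ENNReal.ofReal g) :
    eLpNorm f (ENNReal.ofReal q) P ≤ ENNReal.ofReal (A + B * z + 2 * g) := by
  have hq1 : 1 ≤ ENNReal.ofReal q := ENNReal.one_le_ofReal.2 hq
  have h1 : eLpNorm (fun _ : Ω => A) (ENNReal.ofReal q) P = ENNReal.ofReal A := by
    rw [eLpNorm_const _ (by positivity) (IsProbabilityMeasure.ne_zero P), measure_univ,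
      ENNReal.one_rpow, mul_one, Real.enorm_eq_ofReal hA]
  have h2 : eLpNorm (B • Z) (ENNReal.ofReal q) P ≤ ENNReal.ofReal (B * z) := by
    rw [eLpNorm_const_smul, Real.enorm_eq_ofReal hB, ENNReal.ofReal_mul hB]
    gcongr
  have h3 : eLpNorm ((2 : ℝ) • G) (ENNReal.ofReal q) P ≤ ENNReal.ofReal (2 * g) := by
    rw [eLpNorm_const_smul, Real.enorm_eq_ofReal zero_le_two, ENNReal.ofReal_mul zero_le_two]
    gcongr
  have m1 : AEStronglyMeasurable (fun _ : Ω => A) P := aestronglyMeasurable_const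
  have m2 : AEStronglyMeasurable (B • Z) P := (hZ.const_smul B).aestronglyMeasurable
  have m3 : AEStronglyMeasurable ((2 : ℝ) • G) P := (hG.const_smul (2 : ℝ)).aestronglyMeasurable
  calc eLpNorm f (ENNReal.ofReal q) P
      ≤ eLpNorm ((fun _ : Ω => A) + B • Z + (2 : ℝ) • G) (ENNReal.ofReal q) P :=
        eLpNorm_mono_ae_real hf
    _ ≤ eLpNorm (fun _ : Ω => A) (ENNReal.ofReal q) P + eLpNorm (B • Z) (ENNReal.ofReal q) P
        + eLpNorm ((2 : ℝ) • G) (ENNReal.ofReal q) P :=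
        (eLpNorm_add_le (m1.add m2) m3 hq1).trans (add_le_add_left (eLpNorm_add_le m1 m2 hq1) _)
    _ ≤ ENNReal.ofReal A + ENNReal.ofReal (B * z) + ENNReal.ofReal (2 * g) :=
        add_le_add (add_le_add h1.le h2) h3
    _ = _ := by
        rw [ENNReal.ofReal_add (by positivity) (by positivity),
          ENNReal.ofReal_add hA (by positivity)]

/-- The search term depends on ϑ, so the infimum over ϑ is taken only after integration. -/
lemma le_ofReal_ciInf_add {ι : Type*} [Nonempty ι] {x : ℝ≥0∞} {g : ι → ℝ} (hg : ∀ i, 0 ≤ g i)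
    {y : ℝ} (hy : 0 ≤ y) (h : ∀ i, x ≤ ENNReal.ofReal (g i + y)) :
    x ≤ ENNReal.ofReal ((⨅ i, g i) + y) := by
  have hx : x ≠ ⊤ := ne_top_of_le_ne_top ENNReal.ofReal_ne_top (h (Classical.arbitrary ι))
  rw [← ENNReal.ofReal_toReal hx]
  refine ENNReal.ofReal_le_ofReal ?_
  have : x.toReal - y ≤ ⨅ i, g i := le_ciInf fun i => by
    have := ENNReal.toReal_le_of_le_ofReal (add_nonneg (hg i) hy) (h i)
    linarith
  linarith

end Assembly

end ClippedDNN

/-! ### The overall error estimate -/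

theorem mainTheorem5
    (d D L M K N : ℕ) (_hd : 0 < d) (_hD : 0 < D) (hL : 0 < L) (hM : 0 < M) (hK : 0 < K)
    (_hN : 0 < N)
    (p : ℝ) (hp : 0 < p) (a b u v : ℝ) (hab : a < b) (huv : u < v)
    (c : ℝ) (hc : max 1 (max |a| |b|) ≤ c) (β : ℝ) (hβ : c ≤ β)
    -- the layer dimensions; only `l 0, …, l L` are relevant
    (l : ℕ → ℕ) (hl : ∀ i ≤ L, 0 < l i)
    (NN : Set ℕ) (hNN : NN ⊆ Set.Iic N) (h0NN : 0 ∈ NN)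
    (hl0 : l 0 = d) (hlL : l L = 1)
    (hDl : ClippedDNN.numParams l L ≤ D)
    {Ω : Type*} [MeasurableSpace Ω] (P : Measure Ω) [IsProbabilityMeasure P]
    -- the training samples, i.i.d. random variables with values in `[a,b]^d × [u,v]`
    (X : Fin M → Ω → ClippedDNN.cube d a b) (Y : Fin M → Ω → Set.Icc u v)
    (hX : ∀ j, Measurable (X j)) (hY : ∀ j, Measurable (Y j))
    (hXY_indep : iIndepFun (fun j ω => (X j ω, Y j ω)) P)
    (hXY_ident : ∀ i j, IdentDistrib (fun ω => (X i ω, Y i ω)) (fun ω => (X j ω, Y j ω)) P P)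
    -- the target function, a version of the regression function
    (E : ClippedDNN.cube d a b → Set.Icc u v) (hE : Measurable E)
    (hE_cond : (fun ω => (E (X ⟨0, hM⟩ ω) : ℝ)) =ᵐ[P]
      P[(fun ω => (Y ⟨0, hM⟩ ω : ℝ)) | MeasurableSpace.comap (X ⟨0, hM⟩) inferInstance])
    -- the parameter vectors and the random index of the selected one
    (Θ : ℕ → ℕ → Ω → (Fin D → ℝ)) (hΘ : ∀ k n, Measurable (Θ k n))
    (kk : Ω → ℕ × ℕ) (hkk : Measurable kk)
    (hΘ_indep : iIndepFun (fun (k : Set.Icc 1 K) => Θ k 0) P)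
    (hΘ_ident : ∀ k ∈ Set.Icc 1 K, ∀ k' ∈ Set.Icc 1 K, IdentDistrib (Θ k 0) (Θ k' 0) P P)
    (hΘ_unif : pdf.IsUniform (Θ 1 0) (ClippedDNN.cube D (-c) c) P volume)
    -- the empirical risk
    (R : (Fin D → ℝ) → Ω → ℝ)
    (hR : ∀ θ ω, R θ ω = (1 / (M : ℝ)) *
      ∑ j : Fin M, |ClippedDNN.realNetwork L l hl0 hlL u v θ (X j ω) - (Y j ω : ℝ)| ^ 2)
    (hkk_min : ∀ ω, kk ω ∈ ClippedDNN.argminOn (fun q : ℕ × ℕ => R (Θ q.1 q.2 ω) ω)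
      {q : ℕ × ℕ | q.1 ∈ Set.Icc 1 K ∧ q.2 ∈ NN ∧ ‖Θ q.1 q.2 ω‖ ≤ β}) :
    Measurable (fun ω => ∫⁻ x : ClippedDNN.cube d a b,
        ENNReal.ofReal (|ClippedDNN.realNetwork L l hl0 hlL u v (Θ (kk ω).1 (kk ω).2 ω) (x : Fin d → ℝ)
          - (E x : ℝ)| ^ 2) ∂(P.map (X ⟨0, hM⟩))) ∧
    (∫⁻ ω, (∫⁻ x : ClippedDNN.cube d a b,
        ENNReal.ofReal (|ClippedDNN.realNetwork L l hl0 hlL u v (Θ (kk ω).1 (kk ω).2 ω) (x : Fin d → ℝ)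
          - (E x : ℝ)| ^ 2) ∂(P.map (X ⟨0, hM⟩))) ^ p ∂P) ^ (1 / p)
      ≤ ENNReal.ofReal
        ((⨅ θ : ClippedDNN.cube D (-c) c, ⨆ x : ClippedDNN.cube d a b,
            |ClippedDNN.realNetwork L l hl0 hlL u v (θ : Fin D → ℝ) (x : Fin d → ℝ) - (E x : ℝ)| ^ 2)
          + 4 * (v - u) * L * ((ClippedDNN.width L l : ℝ) + 1) ^ L * c ^ (L + 1) * max p 1
            / (K : ℝ) ^ ((L : ℝ)⁻¹ * (((ClippedDNN.width L l : ℝ) + 1) ^ 2)⁻¹)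
          + 10 * (max (v - u) 1) ^ 2 * L * ((ClippedDNN.width L l : ℝ) + 1) ^ (3 / 2 : ℝ)
            * max p (Real.log (4 * M * β * c)) / √(M : ℝ)) := by
  have hc1 : 1 ≤ c := (le_max_left _ _).trans hc
  have hβ1 : 1 ≤ β := hc1.trans hβ
  have hc0 : 0 < c := by linarith
  have hV : 0 < v - u := sub_pos.2 huv
  have : Nonempty (Fin M) := ⟨⟨0, hM⟩⟩
  have : Nonempty (Set.Icc 1 K) := ⟨⟨1, le_rfl, hK⟩⟩
  have : Nonempty (ClippedDNN.cube D (-c) c) :=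
    ⟨⟨fun _ => 0, fun _ => by simpa using hc0.le, fun _ => hc0.le⟩⟩
  have hlawprob : IsProbabilityMeasure (P.map (X ⟨0, hM⟩)) :=
    Measure.isProbabilityMeasure_map (hX _).aemeasurable
  set i₀ : Fin M := ⟨0, hM⟩ with hi₀
  set f : (Fin D → ℝ) → ClippedDNN.cube d a b → ℝ := fun θ x =>
    ClippedDNN.realNetwork L l hl0 hlL u v θ (x : Fin d → ℝ) with hf
  set Yr : Fin M → Ω → ℝ := fun j ω => (Y j ω : ℝ) with hYr
  set Er : ClippedDNN.cube d a b → ℝ := fun x => (E x : ℝ) with hEr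
  have hfmem : ∀ θ x, f θ x ∈ Set.Icc u v := fun θ x =>
    ClippedDNN.realNetwork_mem_Icc (h0 := hl0) (hL := hlL) hL huv.le θ x
  have hfmeas : ∀ θ, Measurable (f θ) := fun θ =>
    ((ClippedDNN.continuous_realNetwork (h0 := hl0) (hL := hlL)).comp
      (continuous_const.prodMk continuous_subtype_val)).measurable
  have hYm : ∀ j, Measurable (Yr j) := fun j => measurable_subtype_coe.comp (hY j)
  have hYmem : ∀ j ω, Yr j ω ∈ Set.Icc u v := fun j ω => (Y j ω).2
  have hErm : Measurable Er := measurable_subtype_coe.comp hE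
  have hErmem : ∀ x, Er x ∈ Set.Icc u v := fun x => (E x).2
  have hmeasθ := ClippedDNN.measurable_lintegral_realNetwork (D := D) (h0 := hl0) (hL1 := hlL)
    (P.map (X i₀)) hE
  have hsel := ClippedDNN.measurable_apply_index hΘ hkk
  have hmeas := hmeasθ.comp hsel
  refine ⟨hmeas, ?_⟩
  set err : (Fin D → ℝ) → ℝ := fun θ => ∫ ω, (f θ (X i₀ ω) - Er (X i₀ ω)) ^ 2 ∂P with herr
  have herr0 : ∀ θ, 0 ≤ err θ := fun θ => integral_nonneg fun ω => sq_nonneg _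
  have hlint : ∀ θ, ∫⁻ x : ClippedDNN.cube d a b,
      ENNReal.ofReal (|f θ x - Er x| ^ 2) ∂(P.map (X i₀)) = ENNReal.ofReal (err θ) := fun θ => by
    have hm : Measurable fun x => (f θ x - Er x) ^ 2 := ((hfmeas θ).sub hErm).pow_const 2
    simp_rw [sq_abs]
    rw [lintegral_map hm.ennreal_ofReal (hX i₀), herr, ofReal_integral_eq_lintegral_ofReal]
    · exact ClippedDNN.integrable_of_measurable_of_mem_Icc (hm.comp (hX i₀))
        fun ω => ClippedDNN.sq_sub_mem_Icc (hfmem _ _) (hErmem _)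
    · exact ae_of_all _ fun ω => sq_nonneg _
  set sel : Ω → Fin D → ℝ := fun ω => Θ (kk ω).1 (kk ω).2 ω with hselω
  have herrsel : Measurable fun ω => err (sel ω) := by
    have h1 : (fun ω => err (sel ω)) = fun ω => (∫⁻ x : ClippedDNN.cube d a b,
        ENNReal.ofReal (|f (sel ω) x - Er x| ^ 2) ∂(P.map (X i₀))).toReal := by
      ext ω
      rw [hlint, ENNReal.toReal_ofReal (herr0 _)]
    rw [h1]
    exact hmeas.ennreal_toReal
  set q := max p 1 with hq
  set Λ := max p (Real.log (4 * M * β * c)) with hΛ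
  have hM1 : (1 : ℝ) ≤ M := by exact_mod_cast hM
  -- Holds as 4 > e; it makes Λ dominate `max p 1`.
  have hlog1 : 1 ≤ Real.log (4 * M * β * c) := by
    rw [Real.le_log_iff_exp_le (by positivity)]
    have h1 : (4 : ℝ) ≤ 4 * M * β * c := by
      have : (1 : ℝ) ≤ M * β * c :=
        one_le_mul_of_one_le_of_one_le (one_le_mul_of_one_le_of_one_le hM1 hβ1) hc1
      linarith
    linarith [Real.exp_one_lt_d9]
  have hΛ1 : 1 ≤ Λ := hlog1.trans (le_max_right _ _)
  have hqΛ : q ≤ Λ := max_le (le_max_left _ _) hΛ1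
  have hq1 : 1 ≤ q := le_max_right _ _
  -- Raising the exponent from `p` to `max p 1` is harmless on a probability space and makes
  -- Minkowski's inequality available.
  have hlhs : (∫⁻ ω, (∫⁻ x : ClippedDNN.cube d a b,
      ENNReal.ofReal (|f (sel ω) x - Er x| ^ 2) ∂(P.map (X i₀))) ^ p ∂P) ^ (1 / p)
      ≤ eLpNorm (fun ω => err (sel ω)) (ENNReal.ofReal q) P := by
    refine le_trans (le_of_eq ?_) (eLpNorm_le_eLpNorm_of_exponent_le
      (ENNReal.ofReal_le_ofReal (le_max_left p 1)) herrsel.aestronglyMeasurable)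
    rw [eLpNorm_eq_lintegral_rpow_enorm_toReal (ENNReal.ofReal_pos.2 hp).ne' ENNReal.ofReal_ne_top,
      ENNReal.toReal_ofReal hp.le]
    simp_rw [hlint, Real.enorm_eq_ofReal (herr0 _)]
  refine hlhs.trans ?_
  set W : ℝ := (ClippedDNN.width L l : ℝ) + 1 with hW
  set n := ClippedDNN.numParams l L with hn
  have hn2 : 2 ≤ n := ClippedDNN.two_le_numParams hL hl
  have hnW : (n : ℝ) ≤ L * W ^ 2 := by
    have := ClippedDNN.numParams_le L l
    rw [hW]
    exact_mod_cast this
  have hW2 : 2 ≤ W := by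
    have h1 : 1 ≤ ClippedDNN.width L l :=
      (hl 0 (Nat.zero_le _)).trans_le (ClippedDNN.le_width l (Nat.zero_le _))
    have : (1 : ℝ) ≤ ClippedDNN.width L l := by exact_mod_cast h1
    linarith
  -- the generalization error on a grid
  set N₀ := ⌈c * L * W ^ L * β ^ L * √(M : ℝ)⌉₊ with hN₀
  have hL' : (0 : ℝ) < L := by exact_mod_cast hL
  have hN₀pos : 0 < N₀ := Nat.ceil_pos.2 (by positivity)
  have : Nonempty (Fin N₀) := ⟨⟨0, hN₀pos⟩⟩
  set F : (Fin n → Fin N₀) → Ω → ℝ := fun j ω =>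
    |ClippedDNN.empRisk X Yr (f (ClippedDNN.gridPoint D β j)) ω
      - ClippedDNN.risk P (X i₀) (Yr i₀) (f (ClippedDNN.gridPoint D β j))| with hF
  have hFm : ∀ j, Measurable (F j) := fun j => continuous_abs.measurable.comp
    ((ClippedDNN.measurable_empRisk hX hYm (hfmeas _)).sub_const _)
  have hpair : Measurable fun z : ClippedDNN.cube d a b × Set.Icc u v => (z.1, (z.2 : ℝ)) :=
    measurable_fst.prodMk (measurable_subtype_coe.comp measurable_snd)
  have hind : iIndepFun (fun j ω => (X j ω, Yr j ω)) P :=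
    hXY_indep.comp (fun _ z => (z.1, (z.2 : ℝ))) fun _ => hpair
  have hident : ∀ j, IdentDistrib (fun ω => (X j ω, Yr j ω)) (fun ω => (X i₀ ω, Yr i₀ ω)) P P :=
    fun j => (hXY_ident j i₀).comp hpair
  set G : Ω → ℝ := fun ω => Finset.univ.sup' Finset.univ_nonempty fun j => F j ω with hG
  have hGm : Measurable G := by
    have h : Measurable fun ω => ⨆ j, F j ω := Measurable.iSup hFm
    simpa only [hG, Finset.sup'_univ_eq_ciSup] using h
  have hFG : ∀ j ω, F j ω ≤ G ω := fun j ω =>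
    Finset.le_sup' (fun j => F j ω) (Finset.mem_univ j)
  set S : ℝ := 2 * (L : ℝ) ^ 2 * W ^ 3 * Λ ^ 2 with hS
  have hGq : eLpNorm G (ENNReal.ofReal q) P
      ≤ ENNReal.ofReal (2 * √(S / (2 * M / ((v - u) ^ 2) ^ 2))) := by
    refine ClippedDNN.eLpNorm_sup'_le hFm (fun j ω => abs_nonneg _) (by positivity)
      (fun j t ht => ?_) ?_ (by linarith) ?_
    · simpa only [Fintype.card_fin] using ClippedDNN.measure_lt_abs_empRisk_sub_risk_le hX hYm
        hYmem hind i₀ hident huv (hfmeas (ClippedDNN.gridPoint D β j)) (hfmem _) ht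
    · have hL1 : (1 : ℝ) ≤ L := by exact_mod_cast hL
      have h1 : (1 : ℝ) ≤ (L : ℝ) ^ 2 := one_le_pow₀ hL1
      have h2 : (1 : ℝ) ≤ W ^ 3 := one_le_pow₀ (by linarith)
      have h3 : (1 : ℝ) ≤ (L : ℝ) ^ 2 * W ^ 3 := one_le_mul_of_one_le_of_one_le h1 h2
      have h4 : 1 * Λ ^ 2 ≤ (L : ℝ) ^ 2 * W ^ 3 * Λ ^ 2 := by gcongr
      nlinarith
    · rw [Fintype.card_fun, Fintype.card_fin, Fintype.card_fin, Nat.cast_pow]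
      exact ClippedDNN.log_card_grid_le hL hM hn2 hW2 hnW hc1 hβ1 hΛ1 (le_max_right _ _)
  have hgen : ∀ θ : Fin D → ℝ, ‖θ‖ ≤ β → ∀ ω,
      |ClippedDNN.empRisk X Yr (f θ) ω - ClippedDNN.risk P (X i₀) (Yr i₀) (f θ)|
        ≤ G ω + 4 * (v - u) / √M := fun θ hθ ω => by
    obtain ⟨j, hj⟩ := ClippedDNN.abs_empRisk_sub_risk_le (P := P) (h0 := hl0) (hL1 := hlL) hL hc hβ
      huv hDl hX hYm hYmem i₀ hN₀pos (Nat.le_ceil _) hθ ω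
    exact hj.trans (add_le_add_left (hFG j ω) _)
  have hdecomp : ∀ θ, err θ = ClippedDNN.risk P (X i₀) (Yr i₀) (f θ)
      - ClippedDNN.risk P (X i₀) (Yr i₀) Er := fun θ =>
    ClippedDNN.integral_sq_sub_regression (hX i₀) (hYm i₀) (hYmem i₀) (hfmeas θ) hErm (hfmem θ)
      hErmem hE_cond
  -- the random search
  set T : Set.Icc 1 K → Ω → Fin D → ℝ := fun k => Θ k 0 with hT
  have hTm : ∀ k, Measurable (T k) := fun k => hΘ k 0
  have hTunif : ∀ k, pdf.IsUniform (T k) (ClippedDNN.cube D (-c) c) P volume := fun k => by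
    have h1 := (hΘ_ident k k.2 1 ⟨le_rfl, hK⟩).map_eq
    unfold pdf.IsUniform at hΘ_unif ⊢
    rw [← hΘ_unif]
    exact h1
  have hTball : ∀ᵐ ω ∂P, ∀ k, T k ω ∈ ClippedDNN.cube D (-c) c :=
    ae_all_iff.2 fun k => ClippedDNN.ae_mem_cube_of_isUniform hc0 (hTunif k)
  have hcard : Fintype.card (Set.Icc 1 K) = K := by simp
  have hRemp : ∀ θ ω, R θ ω = ClippedDNN.empRisk X Yr (f θ) ω := fun θ ω => by
    rw [hR, ClippedDNN.empRisk, Fintype.card_fin]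
    simp only [sq_abs, hf, hYr]
  -- The factors are 2(v−u) from the squared loss, L c W^L c^(L-1) from the network, and 2c from the
  -- normalization of `minHeadDist`.
  set B : ℝ := 4 * (v - u) * L * W ^ L * c ^ (L + 1) with hB
  have hB0 : 0 ≤ B := by positivity
  have hsup : ∀ θ x, |f θ x - Er x| ^ 2 ≤ ⨆ x, |f θ x - Er x| ^ 2 := fun θ x => by
    -- Boundedness matters: an unbounded real supremum would be `0`.
    refine le_ciSup (f := fun x => |f θ x - Er x| ^ 2) ⟨(v - u) ^ 2, ?_⟩ x
    rintro _ ⟨x, rfl⟩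
    dsimp only
    rw [sq_abs]
    exact (ClippedDNN.sq_sub_mem_Icc (hfmem θ x) (hErmem x)).2
  have hsup0 : ∀ θ, 0 ≤ ⨆ x, |f θ x - Er x| ^ 2 := fun θ =>
    Real.iSup_nonneg fun x => by positivity
  have herr_le : ∀ θ, err θ ≤ ⨆ x, |f θ x - Er x| ^ 2 := fun θ => by
    have h1 : err θ ≤ ∫ _ω, (⨆ x, |f θ x - Er x| ^ 2) ∂P := by
      refine integral_mono (ClippedDNN.integrable_of_measurable_of_mem_Icc
        (((hfmeas θ).sub hErm).pow_const 2 |>.comp (hX i₀))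
        fun ω => ClippedDNN.sq_sub_mem_Icc (hfmem _ _) (hErmem _)) (integrable_const _) fun ω => ?_
      have := hsup θ (X i₀ ω)
      rwa [sq_abs] at this
    simpa using h1
  have hpath : ∀ ϑ ∈ ClippedDNN.cube D (-c) c, ∀ᵐ ω ∂P, ‖err (sel ω)‖
      ≤ ((⨆ x, |f ϑ x - Er x| ^ 2) + 8 * (v - u) / √M)
        + B * ClippedDNN.minHeadDist c n T ϑ ω + 2 * G ω := fun ϑ hϑ => by
    filter_upwards [hTball] with ω hω
    rw [Real.norm_of_nonneg (herr0 _)]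
    have hϑc := ClippedDNN.norm_le_of_mem_cube hc0.le hϑ
    obtain ⟨⟨-, -, hnorm⟩, hmin⟩ := hkk_min ω
    obtain ⟨k, hk⟩ := ClippedDNN.exists_headDist_eq hc0 n T ϑ ω
    have hkc := ClippedDNN.norm_le_of_mem_cube hc0.le (hω k)
    -- The pair `(k, 0)` competes in the minimization: `0 ∈ NN`, and the starting vector has norm at
    -- most `c ≤ β`.
    have h1 : R (sel ω) ω ≤ R (T k ω) ω :=
      isMinOn_iff.1 hmin ((k : ℕ), 0) ⟨k.2, h0NN, hkc.trans hβ⟩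
    rw [hRemp, hRemp] at h1
    have h2 := ClippedDNN.abs_empRisk_sub_le (X := X) hYmem huv.le (hfmem (T k ω)) (hfmem ϑ)
      (fun x => ClippedDNN.abs_realNetwork_sub_le_headDist hc1 hc hkc hϑc x) ω
    -- The selected vector depends on the data, which is why a uniform deviation bound is needed.
    have h3 := hgen (sel ω) hnorm ω
    have h4 := hgen ϑ (hϑc.trans hβ) ω
    have h5 := herr_le ϑ
    rw [hdecomp] at h5 ⊢
    have h6 : 2 * (v - u) * (L * ClippedDNN.headDist n (T k ω) ϑ * c * W ^ L * c ^ (L - 1))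
        = B * ClippedDNN.minHeadDist c n T ϑ ω := by
      have h7 : c ^ (L - 1) * c * c = c ^ (L + 1) := by
        rw [← pow_succ, ← pow_succ, Nat.sub_add_cancel hL]
      rw [hk, hB, ← h7]
      ring
    rw [← hn, ← hW, h6] at h2
    have h8 : 8 * (v - u) / √(M : ℝ) = 4 * (v - u) / √M + 4 * (v - u) / √M := by ring
    rw [h8]
    rw [abs_le] at h2 h3 h4
    linarith
  have hfinal : ∀ ϑ : ClippedDNN.cube D (-c) c,
      eLpNorm (fun ω => err (sel ω)) (ENNReal.ofReal q) P
        ≤ ENNReal.ofReal ((⨆ x, |f ϑ x - Er x| ^ 2)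
          + (B * max p 1 / (K : ℝ) ^ ((L : ℝ)⁻¹ * (W ^ 2)⁻¹)
            + 10 * (max (v - u) 1) ^ 2 * L * W ^ (3 / 2 : ℝ) * Λ / √(M : ℝ))) := fun ϑ => by
    have hZq := ClippedDNN.eLpNorm_minHeadDist_le hc0 hTm hΘ_indep hTunif ϑ.2 hn2 hq1 hnW
    rw [hcard, mul_inv] at hZq
    refine (ClippedDNN.eLpNorm_le_three (ClippedDNN.measurable_minHeadDist c n hTm ϑ) hGm
      (add_nonneg (hsup0 ϑ) (by positivity)) hB0 (by positivity) (by positivity) hq1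
      (hpath ϑ ϑ.2) hZq hGq).trans (ENNReal.ofReal_le_ofReal ?_)
    have h1 := ClippedDNN.generalization_bound_le (M := M) hL hW2 hV hΛ1
    rw [← mul_div_assoc]
    linarith
  have := ClippedDNN.le_ofReal_ciInf_add (fun ϑ : ClippedDNN.cube D (-c) c => hsup0 ϑ)
    (by positivity) hfinal
  rw [← add_assoc] at this
  exact this
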